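/- Let $q^{1/2}$ be an indeterminate, put $[k]=\frac{1-q^k}{1-q}$, $[k]!=\prod_{i=1}^k[i]$, and $$S_{m,n}(q)=\sum_{k=1}^{n}\frac{[2k]}{[2]}\,[k]^{m-1}q^{\frac{m+1}{2}(n-k)} .$$ There are polynomials $P_{m,k}\in\mathbb Z[q]$ ($0\le k\le m$) such that for all $m\ge 0$, $n\ge 1$ $$S_{2m+1,n}(q)=\sum_{k=0}^m(-q^n)^{m-k}\frac{[k]!}{[m+1]!}P_{m,m-k}(q)\frac{([n][n+1])^{k+1}}{[2]},$$ and polynomials $Q_{m,k}\in\mathbb Z[q]$ ($m\ge 1$, $0\le k\le m$) such that for all $m,n\ge 1$ $$S_{2m,n}(q)=(1-q^{n+\frac12})\sum_{k=0}^m(-q^n)^{m-k}\frac{(1-q^{\frac12})^{m-k}Q_{m,m-k}(q^{\frac12})}{\prod_{i=0}^{m-k}(1-q^{m-i+\frac12})}\frac{([n][n+1])^{k}}{[2]} .$$ These polynomials are uniquely determined and have the following description. A lattice path is a finite sequence of points of $\mathbb Z^2$ in which each step is $(1,0)$ (horizontal) or $(0,1)$ (vertical); its weight is the product of the weights of its steps,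 and the weight of a family of paths is the product of the weights of its members. For $0\le k\le m$ and $0\le i\le k-1$ let $$u_i=(2i,-2i),\qquad v_i=(2i+3,\,m-k-i-1),$$ and consider all families $(p_0,\dots,p_{k-1})$ in which $p_i$ is a lattice path from $u_i$ to $v_i$ and no two of the paths have a point in common. (i) For $0\le k\le m$, $P_{m,k}(q)$ is the sum of the weights of these families when every vertical step with even $x$-coordinate has weight $q$ and every other step has weight $1$. (ii) For $m\ge 1$ and $0\le k\le m$, $Q_{m,k}(q)$ is the sum of the weights of these families when every vertical step starting from one of the points $u_j$ $(0\le j\le k-1)$ has weight $q^2+q$, every other vertical step with even $x$-coordinate has weight $q^2$, and every other step has weight $1$. Consequently $P_{m,k}$ and $Q_{m,k}$ have nonnegative integer coefficients. -/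

import Mathlib

open Polynomial

/-! ### Lattice paths -/

/-- A unit step to the right or upwards in `ℤ × ℤ`. -/
def LatticeStep (a b : ℤ × ℤ) : Prop :=
  b = (a.1 + 1, a.2) ∨ b = (a.1, a.2 + 1)

/-- The list of points `s` is a lattice path from `u` to `v`. -/
def IsLatticePath (u v : ℤ × ℤ) (s : List (ℤ × ℤ)) : Prop :=
  s.IsChain LatticeStep ∧ s.head? = some u ∧ s.getLast? = some v

/-- The product of the weights `w a b` over the steps `a → b` of a path. -/
def pathWeight {R : Type*} [CommSemiring R] (w : ℤ × ℤ → ℤ × ℤ → R) (s : List (ℤ × ℤ)) : R :=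
  (List.zipWith w s s.tail).prod

/-- Families `(p₀, …, p₍ₖ₋₁₎)` where `pᵢ` is a lattice path from `uᵢ` to `vᵢ` and no two
of the paths have a point in common. -/
def nonintersectingFamilies {k : ℕ} (u v : Fin k → ℤ × ℤ) : Set (Fin k → List (ℤ × ℤ)) :=
  {p | (∀ i, IsLatticePath (u i) (v i) (p i)) ∧ ∀ i j, i ≠ j → (p i).Disjoint (p j)}

theorem finite_isLatticePath (u v : ℤ × ℤ) : {s | IsLatticePath u v s}.Finite := by
  have key : ∀ n : ℕ, ∀ u : ℤ × ℤ, v.1 + v.2 - (u.1 + u.2) < n →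
      {s | IsLatticePath u v s}.Finite := by
    intro n
    induction n with
    | zero =>
      intro u hu
      have mono : ∀ (s : List (ℤ × ℤ)) (u : ℤ × ℤ), IsLatticePath u v s →
          u.1 + u.2 ≤ v.1 + v.2 := by
        intro s
        induction s with
        | nil => intro u h; simp [IsLatticePath] at h
        | cons a t ih =>
          rintro u ⟨hc, hh, hl⟩
          cases t with
          | nil =>
            simp at hh hl
            subst hh; subst hl; exact le_rfl
          | cons b t =>
            simp only [List.head?_cons, Option.some.injEq] at hh
            subst hh
            rw [List.isChain_cons_cons] at hc
            have := ih b ⟨hc.2, by simp, by simpa using hl⟩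
            rcases hc.1 with h | h <;> simp only [h] at this <;> linarith
      have : {s | IsLatticePath u v s} = ∅ := by
        ext s
        simp only [Set.mem_ofPred_eq, Set.mem_empty_iff_false, iff_false]
        intro h
        have := mono s u h
        push_cast at hu
        linarith
      rw [this]; exact Set.finite_empty
    | succ n ih =>
      intro u hu
      push_cast at hu
      refine Set.Finite.subset
        ((Set.finite_singleton [u]).union
          (((ih (u.1 + 1, u.2) (by simp only; linarith)).image (List.cons u)).union
            ((ih (u.1, u.2 + 1) (by simp only; linarith)).image (List.cons u)))) ?_
      rintro s ⟨hc, hh, hl⟩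
      match s, hc, hh, hl with
      | [a], hc, hh, hl =>
        left
        simpa using hh
      | a :: b :: t, hc, hh, hl =>
        right
        simp only [List.head?_cons, Option.some.injEq] at hh
        subst hh
        rw [List.isChain_cons_cons] at hc
        have hb : IsLatticePath b v (b :: t) := ⟨hc.2, by simp, by simpa using hl⟩
        rcases hc.1 with h | h
        · left; exact ⟨b :: t, by rw [← h]; exact hb, rfl⟩
        · right; exact ⟨b :: t, by rw [← h]; exact hb, rfl⟩
  exact key ((v.1 + v.2 - (u.1 + u.2)).toNat + 1) u (by push_cast; omega)

theorem finite_nonintersectingFamilies {k : ℕ} (u v : Fin k → ℤ × ℤ) :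
    (nonintersectingFamilies u v).Finite :=
  (Set.Finite.pi' fun i => finite_isLatticePath (u i) (v i)).subset fun _ hp => hp.1

/-- The sum, over all non-intersecting families of lattice paths from `u` to `v`, of the
product of the weights of the paths. -/
noncomputable def pathFamilySum {R : Type*} [CommSemiring R] {k : ℕ}
    (w : ℤ × ℤ → ℤ × ℤ → R) (u v : Fin k → ℤ × ℤ) : R :=
  ∑ p ∈ (finite_nonintersectingFamilies u v).toFinset, ∏ i, pathWeight w (p i)

/-- The starting points `uᵢ = (2i, -2i)`. -/
def startPoint (k : ℕ) (i : Fin k) : ℤ × ℤ := (2 * (i : ℤ), -2 * (i : ℤ))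

/-- The end points `vᵢ = (2i + 3, m - k - i - 1)`. -/
def endPoint (m k : ℕ) (i : Fin k) : ℤ × ℤ := (2 * (i : ℤ) + 3, (m : ℤ) - k - i - 1)

open Classical in
/-- Vertical steps with even `x`-coordinate have weight `q`, all other steps weight `1`. -/
noncomputable def weightP (a b : ℤ × ℤ) : ℤ[X] :=
  if a.1 = b.1 ∧ Even a.1 then X else 1

open Classical in
/-- Vertical steps starting from one of the points `uⱼ` have weight `q² + q`, the other vertical
steps with even `x`-coordinate have weight `q²`, all other steps have weight `1`. -/
noncomputable def weightQ {k : ℕ} (u : Fin k → ℤ × ℤ) (a b : ℤ × ℤ) : ℤ[X] :=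
  if a.1 = b.1 ∧ a ∈ Set.range u then X ^ 2 + X
  else if a.1 = b.1 ∧ Even a.1 then X ^ 2 else 1

/-! ### The `q`-analogues of Faulhaber's formula

All identities are identities in the field `ℚ(q^{1/2})` of rational functions. -/

/-- The indeterminate `q^{1/2}`. -/
noncomputable def sqrtQ : RatFunc ℚ := RatFunc.X

/-- The indeterminate `q`. -/
noncomputable def qVar : RatFunc ℚ := sqrtQ ^ 2

/-- `[k] = (1 - q^k) / (1 - q)`. -/
noncomputable def qNumber (k : ℕ) : RatFunc ℚ := (1 - qVar ^ k) / (1 - qVar)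

/-- `[k]! = [1] [2] ⋯ [k]`. -/
noncomputable def qFact (k : ℕ) : RatFunc ℚ := ∏ i ∈ Finset.Icc 1 k, qNumber i

/-- `S_{m,n}(q) = ∑_{k=1}^n ([2k] / [2]) [k]^{m-1} q^{(m+1)(n-k)/2}`. -/
noncomputable def qPowerSum (m n : ℕ) : RatFunc ℚ :=
  ∑ k ∈ Finset.Icc 1 n,
    qNumber (2 * k) / qNumber 2 * qNumber k ^ ((m : ℤ) - 1) * sqrtQ ^ ((m + 1) * (n - k))

/-- The polynomials `P_{m,k}`, `0 ≤ k ≤ m`, are the coefficients in the `q`-Faulhaber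
formula for the odd sums `S_{2m+1,n}(q)`. -/
def IsOddFaulhaberFamily (P : ℕ → ℕ → ℤ[X]) : Prop :=
  ∀ m n : ℕ, 1 ≤ n →
    qPowerSum (2 * m + 1) n =
      ∑ k ∈ Finset.range (m + 1),
        (-qVar ^ n) ^ (m - k) * (qFact k / qFact (m + 1)) * aeval qVar (P m (m - k)) *
          ((qNumber n * qNumber (n + 1)) ^ (k + 1) / qNumber 2)

/-- The polynomials `Q_{m,k}`, `m ≥ 1`, `0 ≤ k ≤ m`, are the coefficients in the `q`-Faulhaber
formula for the even sums `S_{2m,n}(q)`; here `q^{m-i+1/2}` is `(q^{1/2})^{2(m-i)+1}`. -/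
def IsEvenFaulhaberFamily (Q : ℕ → ℕ → ℤ[X]) : Prop :=
  ∀ m n : ℕ, 1 ≤ m → 1 ≤ n →
    qPowerSum (2 * m) n =
      (1 - sqrtQ ^ (2 * n + 1)) *
        ∑ k ∈ Finset.range (m + 1),
          (-qVar ^ n) ^ (m - k) *
            ((1 - sqrtQ) ^ (m - k) * aeval sqrtQ (Q m (m - k)) /
              ∏ i ∈ Finset.range (m - k + 1), (1 - sqrtQ ^ (2 * (m - i) + 1))) *
            ((qNumber n * qNumber (n + 1)) ^ k / qNumber 2)

/-!
Put `yₙ = q⁻ⁿ [n] [n+1]` and `zₙ = q⁻ⁿ [n]²`. The consecutive values `yₙ`, `yₙ₋₁` are the roots of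
`Y² - (1 + q) z Y + (q z² - z)` with `z = zₙ`, so the differences `yₙᵃ⁺¹ - yₙ₋₁ᵃ⁺¹`, and likewise
`pₙ yₙᵃ - pₙ₋₁ yₙ₋₁ᵃ` for `pₙ = q^{-n/2} - q^{(n+1)/2}`, are a fixed multiple (independent of `a`) of
a polynomial `Eₐ(zₙ)` (`mul_pow_sub_mul_pow_eq`). Both cases have the generating function
`∑ Eₐ(z) tᵃ = (1 + s z t) / ((1 - z t) (1 - q z t) - z t²)`, with `s = 0` for the odd sums and
`s = q^{1/2}` for the even ones, so that the coefficient of `zᵇ` in `Eₐ` is the coefficient of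
`t²ᵇ⁻ᵃ` in `(1 + s t) / ((1 - t) (1 - q t))ᵃ⁻ᵇ⁺¹` (`coeff_differencePoly`).

After division by a power of `q^{1/2}` the sums `S_{m,n}` telescope with differences
proportional to `zₙᵐ`. Since the `zₙ` take infinitely many values, the Faulhaber formulas are
equivalent to a triangular linear system with the coefficients of the `Eₐ` as matrix
(`eq_sum_mul_pow_iff`). Cramer's rule solves it by minors (`triangular_system_iff`), and the
denominators in the formulas cancel the products of diagonal entries. Hence `P_{m,k}` and `Q_{m,k}`
are exactly the determinants `faulhaberDet` (`isOddFaulhaberFamily_iff`,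
`isEvenFaulhaberFamily_iff`); this gives existence and uniqueness.

The entries of these determinants are generating functions of lattice paths from `uⱼ` to `vᵢ`, so
the determinants count non-intersecting families by the Lindström–Gessel–Viennot lemma
(`pathFamilySum_eq_det`, `pathFamilySum_eq_faulhaberDet`). As all starting and end points are
ordered from north-west to south-east, the lemma is proved by moving one starting point at a time.
-/

/-! ### Single lattice paths -/

theorem IsLatticePath.mem_bounds {u v : ℤ × ℤ} {s : List (ℤ × ℤ)} (h : IsLatticePath u v s)
    {x : ℤ × ℤ} (hx : x ∈ s) : u ≤ x ∧ x ≤ v := by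
  induction s generalizing u x with
  | nil => simp at hx
  | cons a t ih =>
    obtain ⟨hc, hh, hl⟩ := h
    simp only [List.head?_cons, Option.some.injEq] at hh
    subst hh
    cases t with
    | nil =>
      simp at hl hx
      subst hl; subst hx
      exact ⟨le_rfl, le_rfl⟩
    | cons b t =>
      rw [List.isChain_cons_cons] at hc
      have hb : IsLatticePath b v (b :: t) := ⟨hc.2, by simp, by simpa using hl⟩
      have hab : a ≤ b := by
        rcases hc.1 with h | h <;> rw [h] <;> exact ⟨by simp, by simp⟩
      rcases List.mem_cons.1 hx with rfl | hx
      · exact ⟨le_rfl, hab.trans (ih hb (List.mem_cons_self)).2⟩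
      · exact ⟨hab.trans (ih hb hx).1, (ih hb hx).2⟩

theorem IsLatticePath.head_mem {u v : ℤ × ℤ} {s : List (ℤ × ℤ)} (h : IsLatticePath u v s) :
    u ∈ s := List.mem_of_mem_head? h.2.1

theorem isLatticePath_self_iff {u : ℤ × ℤ} {s : List (ℤ × ℤ)} :
    IsLatticePath u u s ↔ s = [u] := by
  constructor
  · intro h
    match s, h with
    | [], h => simp [IsLatticePath] at h
    | [a], h => simpa using h.2.1
    | a :: b :: t, h =>
      have h1 := h.mem_bounds (x := b) (by simp)
      have h2 := h.mem_bounds (x := a) (by simp)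
      have h3 := (List.isChain_cons_cons.1 h.1).1
      have e1 : b = u := le_antisymm h1.2 h1.1
      have e2 : a = u := le_antisymm h2.2 h2.1
      subst e1; subst e2
      rcases h3 with h | h <;> simp [Prod.ext_iff] at h
  · rintro rfl
    simp [IsLatticePath]

/-- Splitting off the first step of a lattice path. -/
theorem isLatticePath_cons_iff {u v : ℤ × ℤ} (huv : u ≠ v) {s : List (ℤ × ℤ)} :
    IsLatticePath u v s ↔ ∃ t, s = u :: t ∧
      (IsLatticePath (u.1 + 1, u.2) v t ∨ IsLatticePath (u.1, u.2 + 1) v t) := by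
  constructor
  · intro h
    match s, h with
    | [], h => simp [IsLatticePath] at h
    | [a], h =>
      obtain ⟨-, h1, h2⟩ := h
      simp at h1 h2
      exact absurd (h1.symm.trans h2) huv
    | a :: b :: t, h =>
      obtain ⟨hc, h1, h2⟩ := h
      simp only [List.head?_cons, Option.some.injEq] at h1
      subst h1
      rw [List.isChain_cons_cons] at hc
      refine ⟨b :: t, rfl, ?_⟩
      rcases hc.1 with h | h
      · exact Or.inl ⟨hc.2, by simp [h], by simpa using h2⟩
      · exact Or.inr ⟨hc.2, by simp [h], by simpa using h2⟩
  · rintro ⟨t, rfl, h⟩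
    cases t with
    | nil => simp [IsLatticePath] at h
    | cons b t =>
      refine ⟨List.isChain_cons_cons.2 ⟨?_, ?_⟩, by simp, ?_⟩
      · rcases h with h | h
        · exact Or.inl (by simpa using h.2.1)
        · exact Or.inr (by simpa using h.2.1)
      · rcases h with h | h <;> exact h.1
      · rcases h with h | h <;> simpa using h.2.2

theorem pathWeight_cons {R : Type*} [CommSemiring R] (w : ℤ × ℤ → ℤ × ℤ → R) {a b : ℤ × ℤ}
    {t : List (ℤ × ℤ)} (h : t.head? = some b) :
    pathWeight w (a :: t) = w a b * pathWeight w t := by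
  cases t with
  | nil => simp at h
  | cons c t =>
    simp only [List.head?_cons, Option.some.injEq] at h
    subst h
    simp [pathWeight]

/-! ### Non-intersecting families and the Lindström–Gessel–Viennot lemma -/

section Families

variable {R : Type*} {k : ℕ} {u v : Fin k → ℤ × ℤ}

theorem pathFamilySum_eq_zero_of_eq [CommSemiring R] (w : ℤ × ℤ → ℤ × ℤ → R) {i j : Fin k}
    (hij : i ≠ j) (h : u i = u j) : pathFamilySum w u v = 0 := by
  refine Finset.sum_eq_zero fun p hp => ?_
  rw [Set.Finite.mem_toFinset] at hp
  exact absurd (h ▸ (hp.1 j).head_mem) (hp.2 i j hij (hp.1 i).head_mem)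

theorem pathFamilySum_eq_zero_of_not_le [CommSemiring R] (w : ℤ × ℤ → ℤ × ℤ → R) {i : Fin k}
    (h : ¬ u i ≤ v i) : pathFamilySum w u v = 0 := by
  refine Finset.sum_eq_zero fun p hp => ?_
  rw [Set.Finite.mem_toFinset] at hp
  exact absurd ((hp.1 i).mem_bounds (hp.1 i).head_mem).2 h

theorem pathFamilySum_self [CommSemiring R] (w : ℤ × ℤ → ℤ × ℤ → R) (hv : Function.Injective v) :
    pathFamilySum w v v = 1 := by
  have : (finite_nonintersectingFamilies v v).toFinset = {fun i => [v i]} := by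
    ext p
    simp only [Set.Finite.mem_toFinset, Finset.mem_singleton, nonintersectingFamilies,
      isLatticePath_self_iff, Set.mem_ofPred_eq, funext_iff]
    refine ⟨fun h => h.1, fun h => ⟨h, fun i j hij => ?_⟩⟩
    rw [h, h]
    simpa using fun e => hij (hv e).symm
  rw [pathFamilySum, this, Finset.sum_singleton]
  simp [pathWeight]

/-- Prefixing the `i`-th path by a point. -/
def consPath (i : Fin k) (a : ℤ × ℤ) (p : Fin k → List (ℤ × ℤ)) : Fin k → List (ℤ × ℤ) :=
  Function.update p i (a :: p i)

theorem consPath_injective (i : Fin k) (a : ℤ × ℤ) : Function.Injective (consPath i a) := by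
  intro p p' h
  funext j
  have hj := congrFun h j
  by_cases hji : j = i
  · subst hji
    simpa [consPath] using hj
  · simpa [consPath, hji] using hj

theorem prod_pathWeight_consPath [CommSemiring R] (w : ℤ × ℤ → ℤ × ℤ → R) (i : Fin k)
    {a b : ℤ × ℤ} {p : Fin k → List (ℤ × ℤ)} (h : (p i).head? = some b) :
    ∏ j, pathWeight w (consPath i a p j) = w a b * ∏ j, pathWeight w (p j) := by
  rw [← Finset.mul_prod_erase _ _ (Finset.mem_univ i),
    ← Finset.mul_prod_erase Finset.univ (fun j => pathWeight w (p j)) (Finset.mem_univ i),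
    ← mul_assoc]
  congr 1
  · simp only [consPath, Function.update_self]
    exact pathWeight_cons w h
  · refine Finset.prod_congr rfl fun j hj => ?_
    rw [consPath, Function.update_of_ne (Finset.ne_of_mem_erase hj)]

/-- If `u i` cannot lie on any of the other paths, then a non-intersecting family is the same as
a first step of the `i`-th path together with a non-intersecting family for the new starting
points. -/
theorem mem_nonintersectingFamilies_iff {i : Fin k} (hi : u i ≠ v i)
    (hne : ∀ j, j ≠ i → ¬ (u j ≤ u i ∧ u i ≤ v j)) (p : Fin k → List (ℤ × ℤ)) :
    p ∈ nonintersectingFamilies u v ↔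
      ∃ p', (p' ∈ nonintersectingFamilies (Function.update u i ((u i).1 + 1, (u i).2)) v ∨
        p' ∈ nonintersectingFamilies (Function.update u i ((u i).1, (u i).2 + 1)) v) ∧
        consPath i (u i) p' = p := by
  have other : ∀ (b : ℤ × ℤ) (p' : Fin k → List (ℤ × ℤ)),
      (IsLatticePath b (v i) (p' i) → IsLatticePath (u i) (v i) (u i :: p' i)) →
      p' ∈ nonintersectingFamilies (Function.update u i b) v →
      consPath i (u i) p' ∈ nonintersectingFamilies u v := by
    rintro b p' hb ⟨h1, h2⟩
    have h1' : ∀ j, j ≠ i → IsLatticePath (u j) (v j) (p' j) := fun j hj => by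
      simpa [hj] using h1 j
    have hnot : ∀ j, j ≠ i → u i ∉ p' j := fun j hj hm =>
      hne j hj ((h1' j hj).mem_bounds hm)
    refine ⟨fun j => ?_, fun j l hjl => ?_⟩
    · by_cases hj : j = i
      · subst hj
        simpa [consPath] using hb (by simpa using h1 j)
      · simpa [consPath, hj] using h1' j hj
    · by_cases hj : j = i
      · subst hj
        have hl : l ≠ j := hjl.symm
        simp only [consPath, Function.update_self, Function.update_of_ne hl,
          List.disjoint_cons_left]
        exact ⟨hnot l hl, h2 j l hjl⟩
      · by_cases hl : l = i
        · subst hl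
          simp only [consPath, Function.update_self, Function.update_of_ne hj,
            List.disjoint_cons_right]
          exact ⟨hnot j hj, h2 j l hjl⟩
        · simpa [consPath, hj, hl] using h2 j l hjl
  constructor
  · rintro ⟨h1, h2⟩
    obtain ⟨t, ht, hor⟩ := (isLatticePath_cons_iff hi).1 (h1 i)
    have key : ∀ b : ℤ × ℤ, IsLatticePath b (v i) t →
        Function.update p i t ∈ nonintersectingFamilies (Function.update u i b) v := by
      intro b hb
      refine ⟨fun j => ?_, fun j l hjl => ?_⟩
      · by_cases hj : j = i
        · subst hj
          simpa using hb
        · simpa [hj] using h1 j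
      · have hsub : ∀ j, Function.update p i t j ⊆ p j := by
          intro j
          by_cases hj : j = i
          · subst hj
            rw [Function.update_self, ht]
            exact List.subset_cons_self _ _
          · rw [Function.update_of_ne hj]
            exact List.Subset.refl _
        exact fun x hx hx' => h2 j l hjl (hsub j hx) (hsub l hx')
    refine ⟨Function.update p i t, hor.imp (key _) (key _), ?_⟩
    rw [consPath, Function.update_self, ← ht, Function.update_idem, Function.update_eq_self]
  · rintro ⟨p', h | h, rfl⟩
    · exact other _ p' (fun hb => (isLatticePath_cons_iff hi).2 ⟨_, rfl, Or.inl hb⟩) h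
    · exact other _ p' (fun hb => (isLatticePath_cons_iff hi).2 ⟨_, rfl, Or.inr hb⟩) h

/-- The recursion for the generating function of non-intersecting families. The hypothesis `hne`
says that no other path can pass through `u i`. -/
theorem pathFamilySum_step [CommSemiring R] (w : ℤ × ℤ → ℤ × ℤ → R) {i : Fin k} (hi : u i ≠ v i)
    (hne : ∀ j, j ≠ i → ¬ (u j ≤ u i ∧ u i ≤ v j)) :
    pathFamilySum w u v =
      w (u i) ((u i).1 + 1, (u i).2) *
          pathFamilySum w (Function.update u i ((u i).1 + 1, (u i).2)) v +
        w (u i) ((u i).1, (u i).2 + 1) *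
          pathFamilySum w (Function.update u i ((u i).1, (u i).2 + 1)) v := by
  classical
  have hhead : ∀ (b : ℤ × ℤ) (p : Fin k → List (ℤ × ℤ)),
      p ∈ (finite_nonintersectingFamilies (Function.update u i b) v).toFinset →
      (p i).head? = some b := by
    intro b p hp
    rw [Set.Finite.mem_toFinset] at hp
    simpa using (hp.1 i).2.1
  have hset : (finite_nonintersectingFamilies u v).toFinset =
      ((finite_nonintersectingFamilies
          (Function.update u i ((u i).1 + 1, (u i).2)) v).toFinset ∪
        (finite_nonintersectingFamilies
          (Function.update u i ((u i).1, (u i).2 + 1)) v).toFinset).image (consPath i (u i)) := by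
    ext p
    simp only [Set.Finite.mem_toFinset, Finset.mem_image, Finset.mem_union]
    exact mem_nonintersectingFamilies_iff hi hne p
  rw [pathFamilySum, hset, Finset.sum_image (consPath_injective i (u i)).injOn,
    Finset.sum_union, pathFamilySum, pathFamilySum, Finset.mul_sum, Finset.mul_sum]
  · congr 1 <;>
      exact Finset.sum_congr rfl fun p hp => prod_pathWeight_consPath w i (hhead _ p hp)
  · rw [Finset.disjoint_left]
    intro p hp hp'
    have := (hhead _ p hp).symm.trans (hhead _ p hp')
    simp at this

/-- A matrix with a zero block of rows `≥ i` and columns `≤ i` is singular. -/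
theorem det_eq_zero_of_zero_block [CommRing R] (M : Matrix (Fin k) (Fin k) R) (i : Fin k)
    (h : ∀ a b, i ≤ a → b ≤ i → M a b = 0) : M.det = 0 := by
  rw [Matrix.det_apply]
  refine Finset.sum_eq_zero fun σ _ => ?_
  suffices ∃ b, b ≤ i ∧ i ≤ σ b by
    obtain ⟨b, hb, hσ⟩ := this
    rw [Finset.prod_eq_zero (f := fun c => M (σ c) c) (Finset.mem_univ b) (h _ _ hσ hb), smul_zero]
  by_contra! hcon
  -- otherwise `σ` maps the `i + 1` indices `≤ i` injectively to the `i` indices `< i`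
  have := Finset.card_le_card_of_injOn (s := Finset.Iic i) (t := Finset.Iio i) σ
    (fun b hb => by simpa using hcon b (by simpa using hb)) σ.injective.injOn
  simp at this

/-- The Lindström–Gessel–Viennot lemma for starting and end points that are ordered from
north-west to south-east. The entries `W a j` are only required to satisfy the recursion for the
generating function of the paths from `a` to `v j`, and only for points `a` of a set `S` that is
closed under steps. Instead of a sign-reversing involution, both sides are shown to obey the same
recursion when, among the starting points that are not yet end points, one with minimal `x + y`
takes a step. -/
theorem pathFamilySum_eq_det [CommRing R] (w : ℤ × ℤ → ℤ × ℤ → R)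
    (hv1 : StrictMono fun i => (v i).1) (hv2 : StrictAnti fun i => (v i).2)
    (S : Set (ℤ × ℤ)) (hS1 : ∀ a ∈ S, (a.1 + 1, a.2) ∈ S) (hS2 : ∀ a ∈ S, (a.1, a.2 + 1) ∈ S)
    (W : ℤ × ℤ → Fin k → R) (hone : ∀ j, W (v j) j = 1)
    (hzero : ∀ a j, ¬ a ≤ v j → W a j = 0)
    (hrec : ∀ a ∈ S, ∀ j, a ≠ v j → W a j =
      w a (a.1 + 1, a.2) * W (a.1 + 1, a.2) j + w a (a.1, a.2 + 1) * W (a.1, a.2 + 1) j)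
    (hu1 : Monotone fun i => (u i).1) (hu2 : Antitone fun i => (u i).2) (huS : ∀ i, u i ∈ S) :
    pathFamilySum w u v = (Matrix.of fun i j => W (u i) j).det := by
  obtain ⟨n, hn⟩ : ∃ n : ℕ, ∑ i, ((v i).1 + (v i).2 - ((u i).1 + (u i).2)).toNat < n :=
    ⟨_, Nat.lt_succ_self _⟩
  induction n generalizing u with
  | zero => simp at hn
  | succ n ih =>
  by_cases hle : ∀ i, u i ≤ v i
  swap
  · push Not at hle
    obtain ⟨i, hi⟩ := hle
    rw [pathFamilySum_eq_zero_of_not_le w hi]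
    symm
    have hi' : (v i).1 < (u i).1 ∨ (v i).2 < (u i).2 := by
      by_contra! hcon
      exact hi ⟨hcon.1, hcon.2⟩
    rcases hi' with hi' | hi'
    -- the points `u a`, `a ≥ i`, lie to the right of the points `v b`, `b ≤ i`
    · refine det_eq_zero_of_zero_block _ i fun a b ha hb => hzero _ _ fun hab => ?_
      have h1 := hu1 ha
      have h2 := hv1.monotone hb
      have h3 := hab.1
      simp only at h1 h2
      linarith
    -- the points `u b`, `b ≤ i`, lie above the points `v a`, `a ≥ i`
    · rw [← Matrix.det_transpose]
      refine det_eq_zero_of_zero_block _ i fun a b ha hb => hzero _ _ fun hab => ?_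
      have h1 := hu2 hb
      have h2 := hv2.antitone ha
      have h3 := hab.2
      simp only at h1 h2
      linarith
  by_cases hinj : Function.Injective u
  swap
  · rw [Function.Injective] at hinj
    push Not at hinj
    obtain ⟨i, j, he, hij⟩ := hinj
    rw [pathFamilySum_eq_zero_of_eq w hij he]
    exact (Matrix.det_zero_of_row_eq hij (by funext l; simp [he])).symm
  by_cases hall : u = v
  · subst hall
    rw [pathFamilySum_self w hinj]
    have : (Matrix.of fun i j => W (u i) j) = (1 : Matrix (Fin k) (Fin k) R) := by
      ext i j
      by_cases hij : i = j
      · subst hij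
        simp [hone]
      · rw [Matrix.of_apply, Matrix.one_apply_ne hij]
        refine hzero _ _ fun h => ?_
        rcases lt_or_gt_of_ne hij with hlt | hlt
        · exact absurd (hv2 hlt) (not_lt.2 h.2)
        · exact absurd (hv1 hlt) (not_lt.2 h.1)
    rw [this, Matrix.det_one]
  have hact : (Finset.univ.filter fun i => u i ≠ v i).Nonempty := by
    obtain ⟨i, hi⟩ := Function.ne_iff.1 hall
    exact ⟨i, by simpa using hi⟩
  obtain ⟨i, hi, hmin⟩ := Finset.exists_min_image _ (fun i => (u i).1 + (u i).2) hact
  replace hi : u i ≠ v i := by simpa using hi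
  replace hmin : ∀ j, u j ≠ v j → (u i).1 + (u i).2 ≤ (u j).1 + (u j).2 := fun j hj =>
    hmin j (by simpa using hj)
  -- the point `u i` is not an end point, since otherwise it could not reach `v i`
  have hiv : ∀ j, u i ≠ v j := by
    intro j hj
    rcases lt_trichotomy i j with hlt | rfl | hlt
    · have h1 := hv1 hlt
      have h2 := (hle i).1
      rw [hj] at h2
      simp only at h1
      linarith
    · exact hi hj
    · have h1 := hv2 hlt
      have h2 := (hle i).2
      rw [hj] at h2
      simp only at h1
      linarith
  have hne : ∀ j, j ≠ i → ¬ (u j ≤ u i ∧ u i ≤ v j) := by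
    rintro j hj ⟨h1, h2⟩
    by_cases hjv : u j = v j
    · exact hj (hinj (le_antisymm h1 (hjv ▸ h2)))
    · have h3 := hmin j hjv
      have h4 := h1.1
      have h5 := h1.2
      exact hj (hinj (Prod.ext (by linarith) (by linarith)))
  have hlevel : (u i).1 + (u i).2 < (v i).1 + (v i).2 := by
    have h1 := (hle i).1
    have h2 := (hle i).2
    by_contra! hcon
    exact hi (Prod.ext (by linarith) (by linarith))
  have hdec : ∀ b : ℤ × ℤ, b.1 + b.2 = (u i).1 + (u i).2 + 1 →
      ∑ j, ((v j).1 + (v j).2 -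
        ((Function.update u i b j).1 + (Function.update u i b j).2)).toNat < n := by
    intro b hb
    refine lt_of_lt_of_le (Finset.sum_lt_sum (fun j _ => ?_) ⟨i, Finset.mem_univ i, ?_⟩)
      (Nat.lt_succ_iff.1 hn)
    · by_cases hj : j = i
      · subst hj
        rw [Function.update_self]
        omega
      · rw [Function.update_of_ne hj]
    · rw [Function.update_self]
      omega
  -- a step of the `i`-th point keeps the starting points weakly ordered: a point in its way would
  -- have smaller `x + y`, hence be its own end point, which the order of the end
  -- points excludes
  have hstep1 : ∀ j, i < j → (u i).1 + 1 ≤ (u j).1 := by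
    intro j hij
    have h1 := hu1 hij.le
    have h2 := hu2 hij.le
    simp only at h1 h2
    by_contra! hcon
    have h3 : (u j).1 = (u i).1 := by linarith
    by_cases hjv : u j = v j
    · have h4 := hv1 hij
      have h5 := (hle i).1
      simp only [← hjv] at h4
      linarith
    · have h4 := hmin j hjv
      exact hij.ne (hinj (Prod.ext (by linarith) (by linarith)))
  have hstep2 : ∀ j, j < i → (u i).2 + 1 ≤ (u j).2 := by
    intro j hij
    have h1 := hu1 hij.le
    have h2 := hu2 hij.le
    simp only at h1 h2
    by_contra! hcon
    have h3 : (u j).2 = (u i).2 := by linarith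
    by_cases hjv : u j = v j
    · have h4 := hv2 hij
      have h5 := (hle i).2
      simp only [← hjv] at h4
      linarith
    · have h4 := hmin j hjv
      exact hij.ne (hinj (Prod.ext (by linarith) (by linarith)))
  have hupd : ∀ b : ℤ × ℤ, (Matrix.of fun l j => W (Function.update u i b l) j) =
      (Matrix.of fun l j => W (u l) j).updateRow i (W b) := by
    intro b
    ext l j
    by_cases hl : l = i
    · subst hl
      simp
    · simp [hl, Matrix.updateRow_ne]
  have hmono1 : ∀ b : ℤ × ℤ, (u i).1 ≤ b.1 → (∀ j, i < j → b.1 ≤ (u j).1) →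
      Monotone fun l => (Function.update u i b l).1 := by
    intro b hb hb' l j hlj
    rcases hlj.eq_or_lt with rfl | hlt
    · exact le_rfl
    by_cases hl : l = i
    · subst hl
      simpa [hlt.ne'] using hb' j hlt
    · by_cases hj : j = i
      · subst hj
        simpa [hl] using (hu1 hlj).trans hb
      · simpa [hl, hj] using hu1 hlj
  have hmono2 : ∀ b : ℤ × ℤ, (u i).2 ≤ b.2 → (∀ j, j < i → b.2 ≤ (u j).2) →
      Antitone fun l => (Function.update u i b l).2 := by
    intro b hb hb' l j hlj
    rcases hlj.eq_or_lt with rfl | hlt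
    · exact le_rfl
    by_cases hl : l = i
    · subst hl
      simpa [hlt.ne'] using (hu2 hlj).trans hb
    · by_cases hj : j = i
      · subst hj
        simpa [hl] using hb' l hlt
      · simpa [hl, hj] using hu2 hlj
  have hSupd : ∀ b ∈ S, ∀ j, Function.update u i b j ∈ S := by
    intro b hb j
    by_cases hj : j = i
    · subst hj
      simpa using hb
    · simpa [hj] using huS j
  rw [pathFamilySum_step w hi hne,
    ih (u := Function.update u i ((u i).1 + 1, (u i).2)) (hmono1 _ (by simp) hstep1)
      (hmono2 _ le_rfl fun j hj => hu2 hj.le) (hSupd _ (hS1 _ (huS i)))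
      (hdec _ (by simp only; ring)),
    ih (u := Function.update u i ((u i).1, (u i).2 + 1))
      (hmono1 _ le_rfl fun j hj => hu1 hj.le)
      (hmono2 _ (by simp) hstep2) (hSupd _ (hS2 _ (huS i))) (hdec _ (by simp only; ring)),
    hupd, hupd, ← Matrix.det_updateRow_smul, ← Matrix.det_updateRow_smul,
    ← Matrix.det_updateRow_add]
  congr 1
  ext l j
  by_cases hl : l = i
  · subst hl
    simp [hrec _ (huS l) j (hiv j)]
  · simp [Matrix.updateRow_ne hl]

end Families

/-! ### Lattice paths with two alternating weights and difference polynomials -/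

section LineSums

variable {R : Type*} [CommRing R]

/-- The generating function of the lattice paths from a point to the point `D` steps to the right
and `d` steps up, when a vertical step at horizontal distance `e` from the end has weight `q` for
odd `e` and weight `1` for even `e`. For `D = 2r + 1` this is the complete homogeneous symmetric
polynomial of degree `d` in `r + 1` variables `1` and `r + 1` variables `q`. -/
def lineSum (q : R) : ℕ → ℕ → R
  | 0, _ => 1
  | _ + 1, 0 => 1
  | D + 1, d + 1 => lineSum q D (d + 1) + (if Even D then q else 1) * lineSum q (D + 1) d

/-- `lineSum` extended by `0` to negative heights. -/
def lineSumInt (q : R) (D : ℕ) (d : ℤ) : R := if 0 ≤ d then lineSum q D d.toNat else 0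

theorem lineSumInt_of_neg (q : R) (D : ℕ) {d : ℤ} (hd : d < 0) : lineSumInt q D d = 0 :=
  if_neg (not_le.2 hd)

theorem lineSumInt_zero_left (q : R) {d : ℤ} (hd : 0 ≤ d) : lineSumInt q 0 d = 1 := by
  rw [lineSumInt, if_pos hd, lineSum]

theorem lineSumInt_zero_right (q : R) (D : ℕ) : lineSumInt q D 0 = 1 := by
  cases D <;> simp [lineSumInt, lineSum]

theorem lineSumInt_succ (q : R) (D : ℕ) (d : ℤ) :
    lineSumInt q (D + 1) d =
      lineSumInt q D d + (if Even D then q else 1) * lineSumInt q (D + 1) (d - 1) := by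
  rcases lt_trichotomy d 0 with hd | rfl | hd
  · rw [lineSumInt_of_neg q _ hd, lineSumInt_of_neg q _ hd, lineSumInt_of_neg q _ (by omega)]
    ring
  · rw [lineSumInt_zero_right, lineSumInt_zero_right, lineSumInt_of_neg q _ (by omega)]
    ring
  · obtain ⟨n, rfl⟩ : ∃ n : ℕ, d = (n : ℤ) + 1 := ⟨(d - 1).toNat, by omega⟩
    have h1 : ((n : ℤ) + 1).toNat = n + 1 := by omega
    simp only [lineSumInt, add_sub_cancel_right, h1, Int.toNat_natCast, lineSum]
    rw [if_pos hd.le, if_pos hd.le, if_pos (Int.natCast_nonneg n)]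

theorem lineSumInt_two_mul_add_one (q : R) (r : ℕ) (d : ℤ) :
    lineSumInt q (2 * r + 1) d = lineSumInt q (2 * r) d + q * lineSumInt q (2 * r + 1) (d - 1) := by
  rw [lineSumInt_succ, if_pos (even_two_mul r)]

theorem lineSumInt_two_mul_add_two (q : R) (r : ℕ) (d : ℤ) :
    lineSumInt q (2 * r + 2) d =
      lineSumInt q (2 * r + 1) d + lineSumInt q (2 * r + 2) (d - 1) := by
  rw [lineSumInt_succ, if_neg (by simp [parity_simps]), one_mul]

theorem map_lineSum {S : Type*} [CommRing S] (f : R →+* S) (q : R) (D d : ℕ) :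
    f (lineSum q D d) = lineSum (f q) D d := by
  induction D generalizing d with
  | zero => simp [lineSum]
  | succ D ihD =>
    induction d with
    | zero => simp [lineSum]
    | succ d ihd =>
      rw [lineSum, lineSum, map_add, map_mul, ihD, ihd]
      split_ifs <;> simp

theorem map_lineSumInt {S : Type*} [CommRing S] (f : R →+* S) (q : R) (D : ℕ) (d : ℤ) :
    f (lineSumInt q D d) = lineSumInt (f q) D d := by
  unfold lineSumInt
  split_ifs
  · exact map_lineSum f q D _
  · exact map_zero f

/-- The coefficient of `t ^ d` in `(1 + s t) / ((1 - t) (1 - q t)) ^ (r + 1)`. -/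
def twoWeightSum (q s : R) (r : ℕ) (d : ℤ) : R :=
  lineSumInt q (2 * r + 1) d + s * lineSumInt q (2 * r + 1) (d - 1)

theorem twoWeightSum_of_neg (q s : R) (r : ℕ) {d : ℤ} (hd : d < 0) : twoWeightSum q s r d = 0 := by
  rw [twoWeightSum, lineSumInt_of_neg q _ hd, lineSumInt_of_neg q _ (by omega)]
  ring

theorem twoWeightSum_zero_right (q s : R) (r : ℕ) : twoWeightSum q s r 0 = 1 := by
  rw [twoWeightSum, lineSumInt_zero_right, lineSumInt_of_neg q _ (by omega)]
  ring

/-- Multiplication of the generating function by `(1 - t) (1 - q t)` lowers `r` by one. -/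
theorem twoWeightSum_succ (q s : R) (r : ℕ) (d : ℤ) :
    twoWeightSum q s (r + 1) d = (1 + q) * twoWeightSum q s (r + 1) (d - 1) -
      q * twoWeightSum q s (r + 1) (d - 2) + twoWeightSum q s r d := by
  have h : ∀ d : ℤ, lineSumInt q (2 * (r + 1) + 1) d =
      (1 + q) * lineSumInt q (2 * (r + 1) + 1) (d - 1) -
        q * lineSumInt q (2 * (r + 1) + 1) (d - 2) + lineSumInt q (2 * r + 1) d := by
    intro d
    have h1 := lineSumInt_two_mul_add_one q (r + 1) d
    have h2 := lineSumInt_two_mul_add_one q (r + 1) (d - 1)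
    have h3 := lineSumInt_two_mul_add_two q r d
    rw [show d - 1 - 1 = d - 2 by ring] at h2
    rw [mul_add, mul_one] at *
    linear_combination h1 - h2 + h3
  have h1 := h d
  have h2 := h (d - 1)
  unfold twoWeightSum
  rw [show d - 2 - 1 = d - 1 - 2 by ring]
  linear_combination h1 + s * h2

theorem twoWeightSum_zero_one (q s : R) : twoWeightSum q s 0 1 = 1 + q + s := by
  rw [twoWeightSum, lineSumInt_two_mul_add_one, lineSumInt_zero_left q (by omega),
    show (1 : ℤ) - 1 = 0 by ring, lineSumInt_zero_right]
  ring

theorem twoWeightSum_zero_add_two (q s : R) {d : ℤ} (hd : 2 ≤ d) :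
    twoWeightSum q s 0 d = (1 + q) * twoWeightSum q s 0 (d - 1) -
      q * twoWeightSum q s 0 (d - 2) := by
  have h : ∀ d : ℤ, 1 ≤ d → lineSumInt q (2 * 0 + 1) d =
      (1 + q) * lineSumInt q (2 * 0 + 1) (d - 1) - q * lineSumInt q (2 * 0 + 1) (d - 2) := by
    intro d hd
    have h1 := lineSumInt_two_mul_add_one q 0 d
    have h2 := lineSumInt_two_mul_add_one q 0 (d - 1)
    rw [lineSumInt_zero_left q (by omega)] at h1 h2
    rw [show d - 1 - 1 = d - 2 by ring] at h2
    linear_combination h1 - h2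
  have h1 := h d (by omega)
  have h2 := h (d - 1) (by omega)
  unfold twoWeightSum
  rw [show d - 2 - 1 = d - 1 - 2 by ring]
  linear_combination h1 + s * h2

/-- Closed form of the diagonal entries of the triangular system: the coefficient of `t ^ k` in
`(1 + s t) / ((1 - t) (1 - q t))`, multiplied by `1 - q`. -/
theorem one_sub_mul_twoWeightSum_zero (q s : R) (k : ℕ) :
    (1 - q) * twoWeightSum q s 0 k = 1 - q ^ (k + 1) + s * (1 - q ^ k) := by
  induction k using Nat.twoStepInduction with
  | zero => simp [twoWeightSum_zero_right]
  | one =>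
    rw [Nat.cast_one, twoWeightSum_zero_one]
    ring
  | more k h1 h2 =>
    rw [twoWeightSum_zero_add_two q s (by push_cast; omega),
      show ((k + 2 : ℕ) : ℤ) - 1 = (k + 1 : ℕ) by push_cast; ring,
      show ((k + 2 : ℕ) : ℤ) - 2 = k by push_cast; ring]
    linear_combination (1 + q) * h2 - q * h1

/-- The coefficient of `z ^ b` in the polynomial `differencePoly q s a` below, equivalently the
generating function of the lattice paths between the points `uᵢ` and `vⱼ` for suitable `i`, `j`. -/
def faulhaberEntry (q s : R) (a b : ℕ) : R :=
  if b ≤ a then twoWeightSum q s (a - b) (2 * b - a) else 0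

theorem faulhaberEntry_of_lt (q s : R) {a b : ℕ} (h : a < b) : faulhaberEntry q s a b = 0 :=
  if_neg (not_le.2 h)

theorem faulhaberEntry_of_two_mul_lt (q s : R) {a b : ℕ} (h : 2 * b < a) :
    faulhaberEntry q s a b = 0 := by
  unfold faulhaberEntry
  split_ifs
  · exact twoWeightSum_of_neg q s _ (by omega)
  · rfl

theorem faulhaberEntry_self (q s : R) (a : ℕ) :
    faulhaberEntry q s a a = twoWeightSum q s 0 a := by
  rw [faulhaberEntry, if_pos le_rfl, Nat.sub_self]
  congr 1
  ring

theorem map_faulhaberEntry {S : Type*} [CommRing S] (f : R →+* S) (q s : R) (a b : ℕ) :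
    f (faulhaberEntry q s a b) = faulhaberEntry (f q) (f s) a b := by
  unfold faulhaberEntry twoWeightSum
  split_ifs <;> simp [map_lineSumInt]

/-- The polynomials `E₀, E₁, …` with
`∑ Eₐ(z) tᵃ = (1 + s z t) / (1 - (1 + q) z t + (q z² - z) t²)`. -/
noncomputable def differencePoly (q s : R) : ℕ → R[X]
  | 0 => 1
  | 1 => C (1 + q + s) * X
  | a + 2 => C (1 + q) * (X * differencePoly q s (a + 1)) -
      C q * (X * (X * differencePoly q s a)) + X * differencePoly q s a

/-- Expansion of `(1 + s z t) / ((1 - z t) (1 - q z t) - z t²)` in powers of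
`z t² / ((1 - z t) (1 - q z t))`, carried out on the level of recursions. -/
theorem coeff_differencePoly (q s : R) (a b : ℕ) :
    (differencePoly q s a).coeff b = faulhaberEntry q s a b := by
  induction a using Nat.twoStepInduction generalizing b with
  | zero =>
    rw [differencePoly, coeff_one]
    rcases b with _ | b
    · rw [faulhaberEntry_self]
      simp [twoWeightSum_zero_right]
    · rw [faulhaberEntry_of_lt q s (by omega)]
      simp
  | one =>
    rw [differencePoly, coeff_C_mul, coeff_X]
    rcases b with _ | _ | b
    · rw [faulhaberEntry_of_two_mul_lt q s (by omega)]
      simp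
    · rw [faulhaberEntry_self, Nat.cast_one, twoWeightSum_zero_one]
      simp
    · rw [faulhaberEntry_of_lt q s (by omega)]
      simp
  | more a h1 h2 =>
    rw [differencePoly, coeff_add, coeff_sub, coeff_C_mul, coeff_C_mul]
    rcases b with _ | _ | b
    · rw [faulhaberEntry_of_two_mul_lt q s (by omega)]
      simp
    · rw [zero_add, coeff_X_mul, coeff_X_mul, coeff_X_mul, coeff_X_mul_zero, h1, h2,
        faulhaberEntry_of_two_mul_lt q s (by omega : 2 * 0 < a + 1)]
      rcases a with _ | a
      · rw [faulhaberEntry_self, faulhaberEntry, if_pos (by omega)]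
        norm_num [twoWeightSum_zero_right]
      · rw [faulhaberEntry_of_two_mul_lt q s (by omega),
          faulhaberEntry_of_two_mul_lt q s (by omega)]
        ring
    · rw [coeff_X_mul, coeff_X_mul, coeff_X_mul, coeff_X_mul, h1, h1, h2]
      rcases lt_trichotomy a b with hab | rfl | hab
      · rw [faulhaberEntry_of_lt q s (by omega), faulhaberEntry_of_lt q s (by omega),
          faulhaberEntry_of_lt q s (by omega), faulhaberEntry_of_lt q s (by omega)]
        ring
      · rw [faulhaberEntry_of_lt q s (by omega : a < a + 1), faulhaberEntry_self,
          faulhaberEntry_self, faulhaberEntry_self,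
          twoWeightSum_zero_add_two q s (d := ((a + 2 : ℕ) : ℤ)) (by push_cast; omega)]
        push_cast
        rw [show (a : ℤ) + 2 - 1 = a + 1 by ring, show (a : ℤ) + 2 - 2 = a by ring]
        ring
      · obtain ⟨r, rfl⟩ := Nat.exists_eq_add_of_lt hab
        rw [faulhaberEntry, if_pos (by omega), faulhaberEntry, if_pos (by omega),
          faulhaberEntry, if_pos (by omega), faulhaberEntry, if_pos (by omega),
          show b + r + 1 + 2 - (b + 2) = r + 1 by omega,
          show b + r + 1 + 1 - (b + 1) = r + 1 by omega,
          show b + r + 1 - b = r + 1 by omega,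
          show b + r + 1 - (b + 1) = r by omega,
          twoWeightSum_succ q s r (2 * ((b + 1 + 1 : ℕ) : ℤ) - ((b + r + 1 + 2 : ℕ) : ℤ))]
        push_cast
        ring_nf

/-- If `y` and `y'` are the roots of `Y² - (1 + q) z Y + (q z² - z)`, then
`p y ^ a - p' y' ^ a` satisfies the recursion of the polynomials `differencePoly q s a`. -/
theorem mul_pow_sub_mul_pow_eq (q s z : R) {y y' p p' c : R} (hadd : y + y' = (1 + q) * z)
    (hmul : y * y' = q * z ^ 2 - z) (h0 : p - p' = c)
    (h1 : p * y - p' * y' = c * ((1 + q + s) * z)) (a : ℕ) :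
    p * y ^ a - p' * y' ^ a = c * (differencePoly q s a).eval z := by
  induction a using Nat.twoStepInduction with
  | zero => simpa [differencePoly] using h0
  | one => simpa [differencePoly] using h1
  | more a ih1 ih2 =>
    simp only [differencePoly, eval_add, eval_sub, eval_mul, eval_C, eval_X]
    linear_combination (1 + q) * z * ih2 - (q * z ^ 2 - z) * ih1 +
      (p * y ^ (a + 1) - p' * y' ^ (a + 1)) * hadd - (p * y ^ a - p' * y' ^ a) * hmul

end LineSums

/-! ### The determinant of path sums -/

section Determinant

variable {R : Type*} [CommRing R]

/-- The determinant that describes the coefficients `P_{m,k}` (for `s = 0`) and `Q_{m,k}`. -/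
noncomputable def faulhaberDet (q s : R) (m k : ℕ) : R :=
  (Matrix.of fun i j : Fin k => faulhaberEntry q s (m - k + i + 1) (m - k + j)).det

theorem map_faulhaberDet {S : Type*} [CommRing S] (f : R →+* S) (q s : R) (m k : ℕ) :
    f (faulhaberDet q s m k) = faulhaberDet (f q) (f s) m k := by
  rw [faulhaberDet, RingHom.map_det, faulhaberDet]
  congr 1
  ext i j
  simp [map_faulhaberEntry]

open Classical in
/-- The weights of the lattice paths: vertical steps from a starting point weigh `q + s`, other
vertical steps with even `x`-coordinate weigh `q`. -/
noncomputable def stepWeight (q s : R) {k : ℕ} (u : Fin k → ℤ × ℤ) (a b : ℤ × ℤ) : R :=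
  if a.1 = b.1 ∧ a ∈ Set.range u then q + s
  else if a.1 = b.1 ∧ Even a.1 then q else 1

open Classical in
/-- The generating function of the lattice paths from `a` to `c`, a point with odd
`x`-coordinate, for the weights `stepWeight q s u`. -/
noncomputable def pathSum (q s : R) {k : ℕ} (u : Fin k → ℤ × ℤ) (a c : ℤ × ℤ) : R :=
  if a.1 ≤ c.1 then
    lineSumInt q (c.1 - a.1).toNat (c.2 - a.2) +
      (if a ∈ Set.range u then s else 0) * lineSumInt q (c.1 - a.1).toNat (c.2 - a.2 - 1)
  else 0

theorem even_of_mem_range_startPoint {k : ℕ} {a : ℤ × ℤ} (h : a ∈ Set.range (startPoint k)) :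
    Even a.1 := by
  obtain ⟨i, rfl⟩ := h
  simp [startPoint]

theorem add_eq_zero_of_mem_range_startPoint {k : ℕ} {a : ℤ × ℤ}
    (h : a ∈ Set.range (startPoint k)) : a.1 + a.2 = 0 := by
  obtain ⟨i, rfl⟩ := h
  simp [startPoint]

theorem pathSum_of_not_le (q s : R) {k : ℕ} (u : Fin k → ℤ × ℤ) {a c : ℤ × ℤ} (h : ¬ a ≤ c) :
    pathSum q s u a c = 0 := by
  unfold pathSum
  by_cases h1 : a.1 ≤ c.1
  · have h3 : c.2 < a.2 := by
      by_contra! h3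
      exact h ⟨h1, h3⟩
    rw [if_pos h1, lineSumInt_of_neg q _ (by omega), lineSumInt_of_neg q _ (by omega)]
    ring
  · rw [if_neg h1]

theorem pathSum_self (q s : R) {k : ℕ} {c : ℤ × ℤ} (hc : Odd c.1) :
    pathSum q s (startPoint k) c c = 1 := by
  have h : c ∉ Set.range (startPoint k) := fun h =>
    Int.not_even_iff_odd.2 hc (even_of_mem_range_startPoint h)
  rw [pathSum, if_pos le_rfl, if_neg h, sub_self, sub_self, lineSumInt_zero_right,
    zero_mul, add_zero]

/-- Splitting off the first step. Above the line of the starting points, a successor of a point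
is never a starting point. -/
theorem pathSum_eq_add (q s : R) {k : ℕ} {a c : ℤ × ℤ} (hc : Odd c.1) (ha : 0 ≤ a.1 + a.2)
    (hac : a ≠ c) :
    pathSum q s (startPoint k) a c =
      stepWeight q s (startPoint k) a (a.1 + 1, a.2) *
          pathSum q s (startPoint k) (a.1 + 1, a.2) c +
        stepWeight q s (startPoint k) a (a.1, a.2 + 1) *
          pathSum q s (startPoint k) (a.1, a.2 + 1) c := by
  have n1 : (a.1 + 1, a.2) ∉ Set.range (startPoint k) := fun h => by
    have := add_eq_zero_of_mem_range_startPoint h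
    simp only at this
    omega
  have n2 : (a.1, a.2 + 1) ∉ Set.range (startPoint k) := fun h => by
    have := add_eq_zero_of_mem_range_startPoint h
    simp only at this
    omega
  have w1 : stepWeight q s (startPoint k) a (a.1 + 1, a.2) = 1 := by
    simp [stepWeight]
  rw [w1, one_mul]
  rcases lt_trichotomy a.1 c.1 with hlt | heq | hlt
  · obtain ⟨D, hD⟩ : ∃ D : ℕ, c.1 - a.1 = (D : ℤ) + 1 := ⟨(c.1 - a.1 - 1).toNat, by omega⟩
    have hD1 : (c.1 - a.1).toNat = D + 1 := by omega
    have hD2 : (c.1 - (a.1 + 1)).toNat = D := by omega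
    have hpar : Even D ↔ Even a.1 := by
      rw [← Int.even_coe_nat, show (D : ℤ) = c.1 - a.1 - 1 by omega]
      simp [hc, parity_simps]
    simp only [pathSum, n1, n2, if_false, zero_mul, add_zero, hD1, hD2]
    rw [if_pos hlt.le, if_pos (Int.add_one_le_iff.2 hlt), if_pos hlt.le, ← sub_sub,
      lineSumInt_succ q D (c.2 - a.2)]
    by_cases hm : a ∈ Set.range (startPoint k)
    · have he := even_of_mem_range_startPoint hm
      rw [if_pos hm, if_pos (hpar.2 he), stepWeight, if_pos ⟨rfl, hm⟩]
      ring
    · by_cases he : Even a.1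
      · rw [if_neg hm, if_pos (hpar.2 he), stepWeight, if_neg (fun h => hm h.2),
          if_pos ⟨rfl, he⟩]
        ring
      · rw [if_neg hm, if_neg (fun h => he (hpar.1 h)), stepWeight, if_neg (fun h => hm h.2),
          if_neg (fun h => he h.2)]
        ring
  · have hne : a.2 ≠ c.2 := fun h => hac (Prod.ext heq h)
    have hodd : ¬ Even a.1 := by
      rw [heq, Int.not_even_iff_odd]
      exact hc
    have hm : a ∉ Set.range (startPoint k) := fun h => hodd (even_of_mem_range_startPoint h)
    simp only [pathSum, n2, hm, if_false, zero_mul, add_zero]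
    rw [if_pos heq.le, if_neg (by omega), if_pos heq.le, stepWeight, if_neg (fun h => hm h.2),
      if_neg (fun h => hodd h.2), heq, sub_self, Int.toNat_zero]
    rcases lt_or_gt_of_ne hne with h | h
    · rw [lineSumInt_zero_left q (by omega), lineSumInt_zero_left q (by omega)]
      ring
    · rw [lineSumInt_of_neg q _ (by omega), lineSumInt_of_neg q _ (by omega)]
      ring
  · simp only [pathSum]
    rw [if_neg (by omega), if_neg (by omega), if_neg (by omega)]
    ring

/-- The entries of the determinant count the paths from `uⱼ` to `vᵢ`: they run over `2 (i - j) + 4`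
vertical lines, half of them with even `x`-coordinate, and the factor `1 + s t` accounts for the
weight `q + s` of a vertical step at `uⱼ`. -/
theorem pathFamilySum_eq_faulhaberDet (q s : R) {m k : ℕ} (hk : k ≤ m) :
    pathFamilySum (stepWeight q s (startPoint k)) (startPoint k) (endPoint m k) =
      faulhaberDet q s m k := by
  have hodd : ∀ j, Odd (endPoint m k j).1 := fun j => ⟨j + 1, by simp [endPoint]; ring⟩
  rw [pathFamilySum_eq_det (stepWeight q s (startPoint k))
    (fun i j hij => by simpa [endPoint] using hij)
    (fun i j hij => by simpa [endPoint] using hij)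
    {a | 0 ≤ a.1 + a.2} (fun a ha => by simp only [Set.mem_ofPred_eq] at *; omega)
    (fun a ha => by simp only [Set.mem_ofPred_eq] at *; omega)
    (fun a j => pathSum q s (startPoint k) a (endPoint m k j))
    (fun j => pathSum_self q s (hodd j))
    (fun a j h => pathSum_of_not_le q s _ h)
    (fun a ha j h => pathSum_eq_add q s (hodd j) ha h)
    (fun i j hij => by simpa [startPoint] using hij)
    (fun i j hij => by simpa [startPoint] using hij)
    (fun i => by simp [startPoint]), faulhaberDet, ← Matrix.det_transpose]
  congr 1
  ext j i
  rw [Matrix.transpose_apply, Matrix.of_apply, Matrix.of_apply, pathSum, faulhaberEntry,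
    if_pos (Set.mem_range_self i)]
  by_cases h : (i : ℕ) ≤ j + 1
  · rw [if_pos (by simp only [startPoint, endPoint]; omega), if_pos (by omega), twoWeightSum]
    simp only [startPoint, endPoint]
    rw [show (2 * ((j : ℕ) : ℤ) + 3 - 2 * ((i : ℕ) : ℤ)).toNat =
        2 * (m - k + j + 1 - (m - k + i)) + 1 by omega,
      show (m : ℤ) - k - (j : ℕ) - 1 - -2 * ((i : ℕ) : ℤ) =
        2 * ((m - k + i : ℕ) : ℤ) - ((m - k + j + 1 : ℕ) : ℤ) by omega]
  · rw [if_neg (by simp only [startPoint, endPoint]; omega), if_neg (by omega)]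

end Determinant

/-! ### Triangular systems -/

section Inversion

/-- Cramer's rule for a triangular system: the solution `x` of `x B = eₘ` is given by minors of
`B`, because the lower right corners of `B` are themselves triangular. -/
theorem mul_prod_eq_of_triangular {R : Type*} [CommRing R] {B : ℕ → ℕ → R}
    (hB : ∀ a b, a < b → B a b = 0) {m : ℕ} {x : ℕ → R}
    (hx : ∀ b ≤ m, ∑ a ∈ Finset.range (m + 1), x a * B a b = if b = m then 1 else 0)
    {k : ℕ} (hk : k ≤ m) :
    x (m - k) * ∏ i ∈ Finset.range (k + 1), B (m - k + i) (m - k + i) =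
      (-1) ^ k * (Matrix.of fun i j : Fin k => B (m - k + i + 1) (m - k + j)).det := by
  let A : Matrix (Fin (k + 1)) (Fin (k + 1)) R := Matrix.of fun i j => B (m - k + i) (m - k + j)
  let y : Fin (k + 1) → R := fun i => x (m - k + i)
  have hdet : A.det = ∏ i ∈ Finset.range (k + 1), B (m - k + i) (m - k + i) := by
    rw [Matrix.det_of_isLowerTriangular, Finset.prod_range]
    · rfl
    · intro i j hij
      exact hB _ _ (Nat.add_lt_add_left (by simpa using hij) _)
  have hy : Matrix.vecMul y A = Pi.single (Fin.last k) 1 := by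
    funext j
    have h1 := hx (m - k + j) (by omega)
    rw [show m + 1 = (m - k) + (k + 1) by omega, Finset.sum_range_add, Finset.sum_eq_zero,
      zero_add, Finset.sum_range] at h1
    · refine h1.trans ?_
      by_cases hj : j = Fin.last k
      · subst hj
        rw [Pi.single_eq_same, if_pos (by simp; omega)]
      · rw [Pi.single_eq_of_ne hj, if_neg]
        intro h
        exact hj (Fin.ext (by simp; omega))
    · intro a ha
      rw [hB a _ (by have := Finset.mem_range.1 ha; omega), mul_zero]
  have h2 : Matrix.vecMul (Matrix.vecMul y A) A.adjugate 0 = A.adjugate (Fin.last k) 0 := by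
    rw [hy, Matrix.single_one_vecMul]
    rfl
  rw [Matrix.vecMul_vecMul, Matrix.mul_adjugate, Matrix.vecMul_smul, Matrix.vecMul_one, hdet,
    Matrix.adjugate_fin_succ_eq_det_submatrix] at h2
  simp only [Pi.smul_apply, smul_eq_mul, y, Fin.val_zero, add_zero, zero_add,
    Fin.val_last] at h2
  rw [mul_comm, h2]
  congr 2
  ext i j
  simp [A, add_assoc]

theorem triangular_system_iff {F : Type*} [Field F] {B : ℕ → ℕ → F}
    (hB : ∀ a b, a < b → B a b = 0) (hdiag : ∀ a, B a a ≠ 0) (m : ℕ) (x : ℕ → F) :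
    (∀ b ≤ m, ∑ a ∈ Finset.range (m + 1), x a * B a b = if b = m then 1 else 0) ↔
      ∀ k ≤ m, x (m - k) * ∏ i ∈ Finset.range (k + 1), B (m - k + i) (m - k + i) =
        (-1) ^ k * (Matrix.of fun i j : Fin k => B (m - k + i + 1) (m - k + j)).det := by
  refine ⟨fun hx k hk => mul_prod_eq_of_triangular hB hx hk, fun h => ?_⟩
  let A : Matrix (Fin (m + 1)) (Fin (m + 1)) F := Matrix.of fun i j => B i j
  have hdet : IsUnit A.det := by
    rw [isUnit_iff_ne_zero, Matrix.det_of_isLowerTriangular]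
    · exact Finset.prod_ne_zero_iff.2 fun i _ => hdiag i
    · intro i j hij
      exact hB _ _ (by simpa using hij)
  let y : ℕ → F := fun a => if ha : a < m + 1 then A⁻¹ (Fin.last m) ⟨a, ha⟩ else 0
  have hy : ∀ b ≤ m, ∑ a ∈ Finset.range (m + 1), y a * B a b = if b = m then 1 else 0 := by
    intro b hb
    have h1 := congrFun (congrFun (Matrix.nonsing_inv_mul A hdet) (Fin.last m))
      ⟨b, Nat.lt_succ_of_le hb⟩
    rw [Matrix.mul_apply, Matrix.one_apply] at h1
    rw [Finset.sum_range]
    refine Eq.trans (Finset.sum_congr rfl fun i _ => ?_) (h1.trans ?_)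
    · simp only [y, A, dif_pos i.isLt, Matrix.of_apply]
    · simp [Fin.ext_iff, eq_comm]
  have hxy : ∀ a ≤ m, x a = y a := by
    intro a ha
    have h1 := h (m - a) (by omega)
    have h2 := mul_prod_eq_of_triangular hB hy (show m - a ≤ m by omega)
    rw [← h2] at h1
    have h3 := mul_right_cancel₀ (Finset.prod_ne_zero_iff.2 fun i _ => hdiag _) h1
    rwa [show m - (m - a) = a by omega] at h3
  intro b hb
  rw [← hy b hb]
  refine Finset.sum_congr rfl fun a ha => ?_
  rw [hxy a (by have := Finset.mem_range.1 ha; omega)]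

end Inversion

/-! ### Expansions of telescoping sums -/

section Telescoping

/-- The expansion of a telescoping sum `T` in the functions `p n * y n ^ a` amounts to a
triangular system, since consecutive differences of these functions are polynomials in `z n`. -/
theorem eq_sum_mul_pow_iff {F : Type*} [Field F] {q s : F} {y p z c T : ℕ → F} {m : ℕ}
    (hdiag : ∀ a : ℕ, twoWeightSum q s 0 a ≠ 0)
    (hadd : ∀ n, y (n + 1) + y n = (1 + q) * z (n + 1))
    (hmul : ∀ n, y (n + 1) * y n = q * z (n + 1) ^ 2 - z (n + 1))
    (hp0 : ∀ n, p (n + 1) - p n = c (n + 1))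
    (hp1 : ∀ n, p (n + 1) * y (n + 1) - p n * y n = c (n + 1) * ((1 + q + s) * z (n + 1)))
    (hc : ∀ n, c (n + 1) ≠ 0) (hz : Function.Injective fun n => z (n + 1))
    (hT0 : T 0 = 0) (hT : ∀ n, T (n + 1) - T n = c (n + 1) * z (n + 1) ^ m)
    (hy0 : y 0 = 0) (hpm : m ≠ 0 ∨ p 0 = 0) (x : ℕ → F) :
    (∀ n, 1 ≤ n → T n = ∑ a ∈ Finset.range (m + 1), x a * (p n * y n ^ a)) ↔
      ∀ k ≤ m, x (m - k) * ∏ i ∈ Finset.range (k + 1), twoWeightSum q s 0 ((m - k + i : ℕ) : ℤ) =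
        (-1) ^ k * faulhaberDet q s m k := by
  have hsys := triangular_system_iff (B := faulhaberEntry q s)
    (fun a b h => faulhaberEntry_of_lt q s h)
    (fun a => by rw [faulhaberEntry_self]; exact hdiag a) m x
  simp only [faulhaberEntry_self] at hsys
  unfold faulhaberDet
  rw [← hsys]
  let G : F[X] := ∑ a ∈ Finset.range (m + 1), C (x a) * differencePoly q s a
  have hGc : ∀ b, G.coeff b = ∑ a ∈ Finset.range (m + 1), x a * faulhaberEntry q s a b := by
    intro b
    simp only [G, finsetSum_coeff, coeff_C_mul, coeff_differencePoly]
  have hG : ∀ n, (∑ a ∈ Finset.range (m + 1), x a * (p (n + 1) * y (n + 1) ^ a)) -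
      ∑ a ∈ Finset.range (m + 1), x a * (p n * y n ^ a) = c (n + 1) * G.eval (z (n + 1)) := by
    intro n
    simp only [G, eval_finsetSum, eval_mul, eval_C, Finset.mul_sum]
    rw [← Finset.sum_sub_distrib]
    refine Finset.sum_congr rfl fun a _ => ?_
    rw [← mul_sub, mul_pow_sub_mul_pow_eq q s _ (hadd n) (hmul n) (hp0 n) (hp1 n) a]
    ring
  have hGiff : G = X ^ m ↔
      ∀ b ≤ m, ∑ a ∈ Finset.range (m + 1), x a * faulhaberEntry q s a b =
        if b = m then 1 else 0 := by
    constructor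
    · intro h b _
      rw [← hGc, h, coeff_X_pow]
    · intro h
      ext b
      rw [coeff_X_pow]
      rcases le_or_gt b m with hb | hb
      · rw [hGc, h b hb]
      · rw [hGc, if_neg hb.ne']
        refine Finset.sum_eq_zero fun a ha => ?_
        rw [faulhaberEntry_of_lt q s (by have := Finset.mem_range.1 ha; omega), mul_zero]
  rw [← hGiff]
  constructor
  · intro h
    refine Polynomial.eq_of_infinite_eval_eq _ _ ?_
    refine Set.Infinite.mono ?_ (Set.infinite_range_of_injective
      (hz.comp (add_left_injective 1)))
    rintro _ ⟨n, rfl⟩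
    have h1 := hG (n + 1)
    rw [← h (n + 1) (by omega), ← h (n + 1 + 1) (by omega), hT] at h1
    simpa using (mul_left_cancel₀ (hc _) h1).symm
  · intro h
    suffices h' : ∀ n, T n = ∑ a ∈ Finset.range (m + 1), x a * (p n * y n ^ a) from
      fun n _ => h' n
    intro n
    induction n with
    | zero =>
      rw [hT0, Finset.sum_range_succ', Finset.sum_eq_zero]
      · rcases hpm with hm | hp
        · -- the coefficient of `z ^ 0` in `G` is `x 0`
          have h0 := hGc 0
          rw [h, coeff_X_pow, if_neg (Ne.symm hm), Finset.sum_range_succ', Finset.sum_eq_zero,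
            faulhaberEntry_self, Nat.cast_zero, twoWeightSum_zero_right] at h0
          · have h1 : x 0 = 0 := by linear_combination -h0
            simp [h1]
          · intro a _
            rw [faulhaberEntry_of_two_mul_lt q s (by omega), mul_zero]
        · simp [hp]
      · intro a _
        simp [hy0]
    | succ n ih =>
      have h1 := hG n
      have h2 := hT n
      rw [h, eval_pow, eval_X] at h1
      linear_combination h2 - h1 + ih

end Telescoping

/-! ### The `q`-Faulhaber formulas in `ℚ(q^{1/2})` -/

section RationalFunctions

theorem sqrtQ_ne_zero : sqrtQ ≠ 0 := RatFunc.X_ne_zero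

theorem sqrtQ_pow_injective : Function.Injective fun n : ℕ => sqrtQ ^ n := by
  intro a b h
  have h1 : algebraMap ℚ[X] (RatFunc ℚ) (X ^ a) = algebraMap ℚ[X] (RatFunc ℚ) (X ^ b) := by
    simpa [sqrtQ] using h
  have h2 := congrArg natDegree (RatFunc.algebraMap_injective ℚ h1)
  simpa using h2

theorem one_sub_sqrtQ_pow_ne_zero {n : ℕ} (hn : n ≠ 0) : 1 - sqrtQ ^ n ≠ 0 := by
  intro h
  exact hn (sqrtQ_pow_injective (show sqrtQ ^ n = sqrtQ ^ 0 by
    rw [pow_zero]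
    linear_combination -h))

theorem one_add_sqrtQ_pow_ne_zero (n : ℕ) : 1 + sqrtQ ^ n ≠ 0 := by
  rcases Nat.eq_zero_or_pos n with rfl | hn
  · norm_num
  · intro h
    refine one_sub_sqrtQ_pow_ne_zero (n := 2 * n) (by omega) ?_
    rw [mul_comm, pow_mul]
    linear_combination (1 - sqrtQ ^ n) * h

theorem one_sub_sqrtQ_ne_zero : 1 - sqrtQ ≠ 0 := by
  simpa using one_sub_sqrtQ_pow_ne_zero one_ne_zero

theorem qVar_ne_zero : qVar ≠ 0 := pow_ne_zero _ sqrtQ_ne_zero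

theorem qVar_pow (n : ℕ) : qVar ^ n = (sqrtQ ^ n) ^ 2 := by
  rw [qVar, ← pow_mul, ← pow_mul, mul_comm]

theorem one_sub_qVar_pow_ne_zero {n : ℕ} (hn : n ≠ 0) : 1 - qVar ^ n ≠ 0 := by
  rw [qVar, ← pow_mul]
  exact one_sub_sqrtQ_pow_ne_zero (by omega)

theorem one_sub_qVar_ne_zero : 1 - qVar ≠ 0 := by
  simpa using one_sub_qVar_pow_ne_zero one_ne_zero

theorem qNumber_ne_zero {n : ℕ} (hn : n ≠ 0) : qNumber n ≠ 0 :=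
  div_ne_zero (one_sub_qVar_pow_ne_zero hn) one_sub_qVar_ne_zero

theorem qNumber_zero : qNumber 0 = 0 := by simp [qNumber]

theorem qNumber_two_mul (n : ℕ) : qNumber (2 * n) = qNumber n * (1 + qVar ^ n) := by
  rw [qNumber, qNumber, mul_comm 2 n, pow_mul]
  ring

theorem aeval_sqrtQ_injective :
    Function.Injective (aeval sqrtQ : ℤ[X] →ₐ[ℤ] RatFunc ℚ) := by
  have h : ∀ p : ℤ[X], aeval sqrtQ p =
      algebraMap ℚ[X] (RatFunc ℚ) (p.map (Int.castRingHom ℚ)) := by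
    intro p
    induction p using Polynomial.induction_on' with
    | add p q hp hq => rw [map_add, hp, hq, Polynomial.map_add, map_add]
    | monomial n a => simp [sqrtQ, ← C_mul_X_pow_eq_monomial]
  intro p p' hp
  rw [h, h] at hp
  exact Polynomial.map_injective _ (RingHom.injective_int _) (RatFunc.algebraMap_injective ℚ hp)

theorem aeval_qVar_injective :
    Function.Injective (aeval qVar : ℤ[X] →ₐ[ℤ] RatFunc ℚ) := by
  intro p p' hp
  rw [qVar, ← expand_aeval, ← expand_aeval] at hp
  exact expand_injective (by norm_num) (aeval_sqrtQ_injective hp)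

theorem qPowerSum_succ (m n : ℕ) :
    qPowerSum m (n + 1) =
      qNumber (2 * (n + 1)) / qNumber 2 * qNumber (n + 1) ^ ((m : ℤ) - 1) +
        sqrtQ ^ (m + 1) * qPowerSum m n := by
  rw [qPowerSum, Finset.sum_Icc_succ_top (by omega), qPowerSum, Finset.mul_sum, add_comm,
    Nat.sub_self, mul_zero, pow_zero, mul_one]
  congr 1
  refine Finset.sum_congr rfl fun k hk => ?_
  rw [Nat.sub_add_comm (Finset.mem_Icc.1 hk).2, mul_add, pow_add, mul_one]
  ring

/-- The sums `S_{m,n}`, normalised so that they telescope. -/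
noncomputable def normPowerSum (m n : ℕ) : RatFunc ℚ :=
  qNumber 2 * (sqrtQ ^ ((m + 1) * n))⁻¹ * qPowerSum m n

theorem normPowerSum_zero (m : ℕ) : normPowerSum m 0 = 0 := by
  simp [normPowerSum, qPowerSum]

theorem normPowerSum_succ_sub (m n : ℕ) :
    normPowerSum m (n + 1) - normPowerSum m n =
      (sqrtQ ^ ((m + 1) * (n + 1)))⁻¹ *
        (qNumber (2 * (n + 1)) * qNumber (n + 1) ^ ((m : ℤ) - 1)) := by
  have h1 := qNumber_ne_zero two_ne_zero
  have h2 := sqrtQ_ne_zero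
  rw [normPowerSum, normPowerSum, qPowerSum_succ,
    show (m + 1) * (n + 1) = (m + 1) * n + (m + 1) by ring, pow_add]
  field_simp
  ring

/-- The argument `q⁻ⁿ [n]²` of the difference polynomials. -/
noncomputable def qSquare (n : ℕ) : RatFunc ℚ := (qVar ^ n)⁻¹ * qNumber n ^ 2

/-- `q⁻ⁿ [n] [n + 1]`, the normalised base of the Faulhaber expansions. -/
noncomputable def qPronic (n : ℕ) : RatFunc ℚ := (qVar ^ n)⁻¹ * (qNumber n * qNumber (n + 1))

theorem qPronic_zero : qPronic 0 = 0 := by simp [qPronic, qNumber_zero]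

/-- Together with `qPronic_mul`: consecutive values of `qPronic` are the roots of
`Y² - (1 + q) z Y + (q z² - z)` for `z = qSquare (n + 1)`. -/
theorem qPronic_add (n : ℕ) :
    qPronic (n + 1) + qPronic n = (1 + qVar) * qSquare (n + 1) := by
  have h1 := one_sub_qVar_ne_zero
  have h2 := qVar_ne_zero
  have h3 := pow_ne_zero n qVar_ne_zero
  simp only [qPronic, qSquare, qNumber, pow_succ]
  field_simp
  ring

theorem qPronic_mul (n : ℕ) :
    qPronic (n + 1) * qPronic n = qVar * qSquare (n + 1) ^ 2 - qSquare (n + 1) := by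
  have h1 := one_sub_qVar_ne_zero
  have h2 := qVar_ne_zero
  have h3 := pow_ne_zero n qVar_ne_zero
  simp only [qPronic, qSquare, qNumber, pow_succ]
  field_simp
  ring

theorem qPronic_sub (n : ℕ) :
    qPronic (n + 1) - qPronic n = (qVar ^ (n + 1))⁻¹ * qNumber (2 * (n + 1)) := by
  have h1 := one_sub_qVar_ne_zero
  have h2 := qVar_ne_zero
  have h3 := pow_ne_zero n qVar_ne_zero
  rw [qNumber_two_mul]
  simp only [qPronic, qNumber, pow_succ]
  field_simp
  ring

theorem qSquare_injective : Function.Injective fun n => qSquare (n + 1) := by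
  intro a b h
  have h1 := one_sub_qVar_ne_zero
  have h2 := pow_ne_zero (a + 1) qVar_ne_zero
  have h3 := pow_ne_zero (b + 1) qVar_ne_zero
  simp only [qSquare, qNumber] at h
  field_simp at h
  have h4 : (qVar ^ (a + 1) - qVar ^ (b + 1)) * (1 - qVar ^ (a + 1 + (b + 1))) = 0 := by
    rw [pow_add qVar (a + 1) (b + 1)]
    linear_combination -h
  rcases mul_eq_zero.1 h4 with h5 | h5
  · rw [qVar, ← pow_mul, ← pow_mul, sub_eq_zero] at h5
    have := sqrtQ_pow_injective h5
    omega
  · exact absurd h5 (one_sub_qVar_pow_ne_zero (by omega))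

theorem twoWeightSum_qVar_zero (a : ℕ) : twoWeightSum qVar 0 0 a = qNumber (a + 1) := by
  rw [qNumber, eq_div_iff one_sub_qVar_ne_zero, mul_comm, one_sub_mul_twoWeightSum_zero]
  ring

theorem twoWeightSum_qVar_sqrtQ (a : ℕ) :
    twoWeightSum qVar sqrtQ 0 a = (1 - sqrtQ ^ (2 * a + 1)) / (1 - sqrtQ) := by
  have h1 : 1 + sqrtQ ≠ 0 := by simpa using one_add_sqrtQ_pow_ne_zero 1
  have h := one_sub_mul_twoWeightSum_zero qVar sqrtQ a
  rw [eq_div_iff one_sub_sqrtQ_ne_zero]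
  generalize twoWeightSum qVar sqrtQ 0 a = t at *
  refine mul_left_cancel₀ h1 ?_
  rw [qVar_pow, qVar_pow, ← pow_mul, ← pow_mul, qVar] at h
  rw [pow_succ, mul_comm 2 a]
  rw [add_mul, pow_add] at h
  linear_combination h

theorem qFact_ne_zero (k : ℕ) : qFact k ≠ 0 :=
  Finset.prod_ne_zero_iff.2 fun i hi =>
    qNumber_ne_zero (by have := (Finset.mem_Icc.1 hi).1; omega)

theorem qFact_mul_prod (a k : ℕ) :
    qFact a * ∏ i ∈ Finset.range k, qNumber (a + i + 1) = qFact (a + k) := by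
  induction k with
  | zero => simp
  | succ k ih =>
    rw [Finset.prod_range_succ, ← mul_assoc, ih, qFact, qFact, ← add_assoc,
      Finset.prod_Icc_succ_top (by omega)]

/-- The odd sums: with `p = y = q⁻ⁿ [n] [n + 1]` and `s = 0`, the diagonal entries are the
`q`-numbers `[a + 1]`, whose products are quotients of `q`-factorials. -/
theorem isOddFaulhaberFamily_iff (P : ℕ → ℕ → ℤ[X]) :
    IsOddFaulhaberFamily P ↔ ∀ m k, k ≤ m → P m k = faulhaberDet X 0 m k := by
  refine forall_congr' fun m => ?_
  have h2 := qNumber_ne_zero two_ne_zero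
  have key := eq_sum_mul_pow_iff (m := m) (q := qVar) (s := 0) (y := qPronic) (p := qPronic)
    (z := qSquare) (c := fun n => (qVar ^ n)⁻¹ * qNumber (2 * n))
    (T := normPowerSum (2 * m + 1))
    (fun a => by rw [twoWeightSum_qVar_zero]; exact qNumber_ne_zero a.succ_ne_zero)
    qPronic_add qPronic_mul qPronic_sub
    (fun n => by
      rw [← qPronic_sub, add_zero, ← qPronic_add]
      ring)
    (fun n => mul_ne_zero (inv_ne_zero (pow_ne_zero _ qVar_ne_zero)) (qNumber_ne_zero (by omega)))
    qSquare_injective (normPowerSum_zero _)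
    (fun n => by
      have e : (((2 * m + 1 : ℕ) : ℤ) - 1) = ((2 * m : ℕ) : ℤ) := by push_cast; ring
      rw [normPowerSum_succ_sub, e, zpow_natCast, qSquare, mul_pow, inv_pow, ← pow_mul,
        ← pow_mul, qVar, ← pow_mul, ← pow_mul]
      have e2 : (2 * m + 1 + 1) * (n + 1) = 2 * (n + 1) + 2 * ((n + 1) * m) := by ring
      rw [e2, pow_add, mul_inv]
      ring)
    qPronic_zero (Or.inr qPronic_zero)
    (fun a => (-1) ^ (m - a) * (qFact a / qFact (m + 1)) * aeval qVar (P m (m - a)))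
  have hodd : ∀ n, qPowerSum (2 * m + 1) n =
      ∑ k ∈ Finset.range (m + 1),
        (-qVar ^ n) ^ (m - k) * (qFact k / qFact (m + 1)) * aeval qVar (P m (m - k)) *
          ((qNumber n * qNumber (n + 1)) ^ (k + 1) / qNumber 2) ↔
      normPowerSum (2 * m + 1) n = ∑ a ∈ Finset.range (m + 1),
        (-1) ^ (m - a) * (qFact a / qFact (m + 1)) * aeval qVar (P m (m - a)) *
          (qPronic n * qPronic n ^ a) := by
    intro n
    have h3 := pow_ne_zero n qVar_ne_zero
    have h4 : sqrtQ ^ ((2 * m + 1 + 1) * n) = (qVar ^ n) ^ (m + 1) := by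
      rw [qVar, ← pow_mul, ← pow_mul]
      congr 1
      ring
    have h5 : qNumber 2 * ((qVar ^ n) ^ (m + 1))⁻¹ ≠ 0 :=
      mul_ne_zero h2 (inv_ne_zero (pow_ne_zero _ h3))
    rw [normPowerSum, h4, ← mul_right_inj' h5, Finset.mul_sum]
    refine Eq.congr rfl (Finset.sum_congr rfl fun k hk => ?_)
    have hk' : m + 1 = (m - k) + (k + 1) := by have := Finset.mem_range.1 hk; omega
    rw [hk', pow_add (qVar ^ n), neg_pow, ← pow_succ', qPronic, ← hk', mul_pow (_)⁻¹ _ (k + 1),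
      inv_pow]
    have h6 := pow_ne_zero (m - k) h3
    have h7 := pow_ne_zero (k + 1) h3
    generalize (qVar ^ n) ^ (m - k) = A at *
    generalize (qVar ^ n) ^ (k + 1) = B at *
    field_simp
  rw [forall₂_congr fun n _ => hodd n, key]
  refine forall₂_congr fun k hk => ?_
  have h3 : qFact (m - k) * ∏ i ∈ Finset.range (k + 1), qNumber (m - k + i + 1) =
      qFact (m + 1) := by
    rw [qFact_mul_prod]
    congr 1
    omega
  simp only [twoWeightSum_qVar_zero]
  rw [show m - (m - k) = k by omega]
  have h4 : (-1 : RatFunc ℚ) ^ k * (qFact (m - k) / qFact (m + 1)) * aeval qVar (P m k) *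
      ∏ i ∈ Finset.range (k + 1), qNumber (m - k + i + 1) =
      (-1) ^ k * aeval qVar (P m k) := by
    have := qFact_ne_zero (m + 1)
    field_simp
    rw [← h3]
    ring
  rw [h4, mul_right_inj' (pow_ne_zero _ (by norm_num)), ← aeval_qVar_injective.eq_iff]
  refine Eq.congr rfl ?_
  have h5 := map_faulhaberDet (aeval qVar : ℤ[X] →ₐ[ℤ] RatFunc ℚ).toRingHom X 0 m k
  simpa using h5.symm

/-- The factor `q^{-n/2} - q^{(n+1)/2}` in the even sums. -/
noncomputable def evenFactor (n : ℕ) : RatFunc ℚ := (sqrtQ ^ n)⁻¹ - sqrtQ ^ (n + 1)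

theorem evenFactor_sub (n : ℕ) :
    evenFactor (n + 1) - evenFactor n =
      (1 - sqrtQ) * (sqrtQ ^ (n + 1) + (sqrtQ ^ (n + 1))⁻¹) := by
  have h1 := sqrtQ_ne_zero
  have h2 := pow_ne_zero n sqrtQ_ne_zero
  simp only [evenFactor, pow_succ]
  field_simp
  ring

theorem evenFactor_mul_qPronic_sub (n : ℕ) :
    evenFactor (n + 1) * qPronic (n + 1) - evenFactor n * qPronic n =
      (1 - sqrtQ) * (sqrtQ ^ (n + 1) + (sqrtQ ^ (n + 1))⁻¹) *
        ((1 + qVar + sqrtQ) * qSquare (n + 1)) := by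
  have h1 := sqrtQ_ne_zero
  have h2 := pow_ne_zero n sqrtQ_ne_zero
  have h3 := one_sub_qVar_ne_zero
  simp only [evenFactor, qPronic, qSquare, qNumber, qVar_pow, pow_succ]
  rw [qVar] at *
  field_simp
  ring

/-- The even sums: here `p` is `evenFactor`, `s = q^{1/2}`, and the diagonal entries are
`(1 - q^{a + 1/2}) / (1 - q^{1/2})`. All differences carry a factor `1 - q^{1/2}`, which is moved
into the unknowns. -/
theorem isEvenFaulhaberFamily_iff (Q : ℕ → ℕ → ℤ[X]) :
    IsEvenFaulhaberFamily Q ↔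
      ∀ m k, 1 ≤ m → k ≤ m → Q m k = faulhaberDet (X ^ 2) X m k := by
  have hrw : IsEvenFaulhaberFamily Q ↔ ∀ m, 1 ≤ m → ∀ n, 1 ≤ n → _ :=
    forall_congr' fun m => forall_comm
  have hrw' : (∀ m k, 1 ≤ m → k ≤ m → Q m k = faulhaberDet (X ^ 2) X m k) ↔
      ∀ m, 1 ≤ m → ∀ k, k ≤ m → Q m k = faulhaberDet (X ^ 2) X m k :=
    forall_congr' fun m => forall_comm
  rw [hrw, hrw']
  refine forall₂_congr fun m hm => ?_
  have h2 := qNumber_ne_zero two_ne_zero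
  have hs := one_sub_sqrtQ_ne_zero
  have key := eq_sum_mul_pow_iff (m := m) (q := qVar) (s := sqrtQ) (y := qPronic)
    (p := evenFactor)
    (z := qSquare) (c := fun n => (1 - sqrtQ) * (sqrtQ ^ n + (sqrtQ ^ n)⁻¹))
    (T := fun n => (1 - sqrtQ) * normPowerSum (2 * m) n)
    (fun a => by
      rw [twoWeightSum_qVar_sqrtQ]
      exact div_ne_zero (one_sub_sqrtQ_pow_ne_zero (by omega)) hs)
    qPronic_add qPronic_mul evenFactor_sub evenFactor_mul_qPronic_sub
    (fun n => by
      have h3 := pow_ne_zero (n + 1) sqrtQ_ne_zero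
      have h4 : sqrtQ ^ (n + 1) + (sqrtQ ^ (n + 1))⁻¹ =
          (1 + sqrtQ ^ ((n + 1) * 2)) / sqrtQ ^ (n + 1) := by
        rw [pow_mul]
        field_simp
        ring
      rw [h4]
      exact mul_ne_zero hs (div_ne_zero (one_add_sqrtQ_pow_ne_zero _) h3))
    qSquare_injective (by simp [normPowerSum_zero])
    (fun n => by
      have h3 := pow_ne_zero (n + 1) sqrtQ_ne_zero
      have h4 := qNumber_ne_zero n.succ_ne_zero
      have e : qNumber (2 * (n + 1)) * qNumber (n + 1) ^ (((2 * m : ℕ) : ℤ) - 1) =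
          (1 + (sqrtQ ^ (n + 1)) ^ 2) * (qNumber (n + 1) ^ 2) ^ m := by
        rw [qNumber_two_mul, qVar_pow, zpow_sub_one₀ h4, zpow_natCast, pow_mul]
        field_simp
      have e2 : (2 * m + 1) * (n + 1) = (n + 1) + ((n + 1) * 2) * m := by ring
      rw [← mul_sub, normPowerSum_succ_sub, e, e2, qSquare, qVar_pow, mul_pow, pow_add, pow_mul,
        pow_mul, inv_pow]
      field_simp
      ring)
    qPronic_zero (Or.inl (by omega))
    (fun a => (1 - sqrtQ) * ((-1) ^ (m - a) * ((1 - sqrtQ) ^ (m - a) *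
      aeval sqrtQ (Q m (m - a)) /
        ∏ i ∈ Finset.range (m - a + 1), (1 - sqrtQ ^ (2 * (m - i) + 1)))))
  have heven : ∀ n, (qPowerSum (2 * m) n =
      (1 - sqrtQ ^ (2 * n + 1)) *
        ∑ k ∈ Finset.range (m + 1),
          (-qVar ^ n) ^ (m - k) *
            ((1 - sqrtQ) ^ (m - k) * aeval sqrtQ (Q m (m - k)) /
              ∏ i ∈ Finset.range (m - k + 1), (1 - sqrtQ ^ (2 * (m - i) + 1))) *
            ((qNumber n * qNumber (n + 1)) ^ k / qNumber 2)) ↔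
      (1 - sqrtQ) * normPowerSum (2 * m) n = ∑ a ∈ Finset.range (m + 1),
        (1 - sqrtQ) * ((-1) ^ (m - a) * ((1 - sqrtQ) ^ (m - a) *
          aeval sqrtQ (Q m (m - a)) /
            ∏ i ∈ Finset.range (m - a + 1), (1 - sqrtQ ^ (2 * (m - i) + 1)))) *
          (evenFactor n * qPronic n ^ a) := by
    intro n
    have h3 := pow_ne_zero n qVar_ne_zero
    have h3' := pow_ne_zero n sqrtQ_ne_zero
    have h4 : sqrtQ ^ ((2 * m + 1) * n) = (qVar ^ n) ^ m * sqrtQ ^ n := by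
      rw [qVar, ← pow_mul, ← pow_mul, ← pow_add]
      congr 1
      ring
    have h5 : (1 - sqrtQ) * (qNumber 2 * ((qVar ^ n) ^ m * sqrtQ ^ n)⁻¹) ≠ 0 :=
      mul_ne_zero hs (mul_ne_zero h2 (inv_ne_zero (mul_ne_zero (pow_ne_zero _ h3) h3')))
    have h8 : evenFactor n = (sqrtQ ^ n)⁻¹ * (1 - sqrtQ ^ (2 * n + 1)) := by
      rw [evenFactor, pow_succ, pow_succ, mul_comm 2 n, pow_mul]
      field_simp
    rw [normPowerSum, h4, ← mul_assoc (1 - sqrtQ), ← mul_right_inj' h5, Finset.mul_sum,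
      Finset.mul_sum, h8]
    refine Eq.congr rfl (Finset.sum_congr rfl fun k hk => ?_)
    have hk' : (qVar ^ n) ^ m = (qVar ^ n) ^ (m - k) * (qVar ^ n) ^ k := by
      rw [← pow_add]
      congr 1
      have := Finset.mem_range.1 hk
      omega
    rw [hk', neg_pow, qPronic, mul_pow (_)⁻¹ _ k, inv_pow]
    have h6 := pow_ne_zero (m - k) h3
    have h7 := pow_ne_zero k h3
    generalize (qVar ^ n) ^ (m - k) = A at *
    generalize (qVar ^ n) ^ k = B at *
    generalize ∏ i ∈ Finset.range (m - k + 1), (1 - sqrtQ ^ (2 * (m - i) + 1)) = D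
    simp only [div_eq_mul_inv]
    field_simp
  rw [forall₂_congr fun n _ => heven n, key]
  refine forall₂_congr fun k hk => ?_
  simp only [twoWeightSum_qVar_sqrtQ]
  rw [show m - (m - k) = k by omega, Finset.prod_div_distrib, Finset.prod_const,
    Finset.card_range]
  have h3 : ∏ i ∈ Finset.range (k + 1), (1 - sqrtQ ^ (2 * (m - i) + 1)) =
      ∏ i ∈ Finset.range (k + 1), (1 - sqrtQ ^ (2 * (m - k + i) + 1)) := by
    rw [← Finset.prod_range_reflect]
    refine Finset.prod_congr rfl fun i hi => ?_
    have := Finset.mem_range.1 hi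
    rw [show m - (k + 1 - 1 - i) = m - k + i by omega]
  have h4 : ∏ i ∈ Finset.range (k + 1), (1 - sqrtQ ^ (2 * (m - k + i) + 1)) ≠ 0 :=
    Finset.prod_ne_zero_iff.2 fun i _ => one_sub_sqrtQ_pow_ne_zero (by omega)
  rw [h3]
  generalize ∏ i ∈ Finset.range (k + 1), (1 - sqrtQ ^ (2 * (m - k + i) + 1)) = D at h4
  have h6 : (1 - sqrtQ) * ((-1) ^ k * ((1 - sqrtQ) ^ k * aeval sqrtQ (Q m k) / D)) *
      (D / (1 - sqrtQ) ^ (k + 1)) = (-1) ^ k * aeval sqrtQ (Q m k) := by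
    rw [pow_succ]
    field_simp
  rw [h6, mul_right_inj' (pow_ne_zero _ (by norm_num)), ← aeval_sqrtQ_injective.eq_iff]
  refine Eq.congr rfl ?_
  have h5 := map_faulhaberDet (aeval sqrtQ : ℤ[X] →ₐ[ℤ] RatFunc ℚ).toRingHom (X ^ 2) X m k
  simpa [qVar] using h5.symm

end RationalFunctions

/-! ### Nonnegativity and the main result -/

section Positivity

theorem weightP_eq_stepWeight (k : ℕ) : weightP = stepWeight X 0 (startPoint k) := by
  funext a b
  unfold weightP stepWeight
  by_cases h : a ∈ Set.range (startPoint k)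
  · by_cases hab : a.1 = b.1
    · rw [if_pos ⟨hab, even_of_mem_range_startPoint h⟩, if_pos ⟨hab, h⟩, add_zero]
    · simp [hab]
  · simp [h]

theorem weightQ_eq_stepWeight {k : ℕ} (u : Fin k → ℤ × ℤ) :
    weightQ u = stepWeight (X ^ 2) X u := rfl

/-- Path sums stay in any subsemiring that contains the weights; for the image of `ℕ[X]` in `ℤ[X]`
this is the nonnegativity of the coefficients. -/
theorem pathFamilySum_mem {R : Type*} [CommSemiring R] (N : Subsemiring R) {k : ℕ}
    {w : ℤ × ℤ → ℤ × ℤ → R} (hw : ∀ a b, w a b ∈ N) (u v : Fin k → ℤ × ℤ) :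
    pathFamilySum w u v ∈ N := by
  refine N.sum_mem fun p _ => N.prod_mem fun i _ => N.list_prod_mem fun x hx => ?_
  obtain ⟨n, hn, rfl⟩ := List.getElem_of_mem hx
  rw [List.getElem_zipWith]
  exact hw _ _

theorem stepWeight_mem {R : Type*} [CommRing R] (N : Subsemiring R) {q s : R} (hq : q ∈ N)
    (hs : s ∈ N) {k : ℕ} (u : Fin k → ℤ × ℤ) (a b : ℤ × ℤ) : stepWeight q s u a b ∈ N := by
  unfold stepWeight
  split_ifs
  · exact N.add_mem hq hs
  · exact hq
  · exact N.one_mem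

theorem coeff_nonneg_of_mem_rangeS {p : ℤ[X]}
    (hp : p ∈ (mapRingHom (Nat.castRingHom ℤ)).rangeS) (d : ℕ) : 0 ≤ p.coeff d := by
  obtain ⟨p, rfl⟩ := hp
  simp

theorem X_mem_rangeS : (X : ℤ[X]) ∈ (mapRingHom (Nat.castRingHom ℤ)).rangeS := ⟨X, by simp⟩

theorem faulhaberDet_coeff_nonneg {q s : ℤ[X]}
    (hq : q ∈ (mapRingHom (Nat.castRingHom ℤ)).rangeS)
    (hs : s ∈ (mapRingHom (Nat.castRingHom ℤ)).rangeS) {m k : ℕ} (hk : k ≤ m) (d : ℕ) :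
    0 ≤ (faulhaberDet q s m k).coeff d := by
  rw [← pathFamilySum_eq_faulhaberDet q s hk]
  exact coeff_nonneg_of_mem_rangeS (pathFamilySum_mem _ (stepWeight_mem _ hq hs _) _ _) d

end Positivity

theorem mainTheorem1 :
    (∃ P : ℕ → ℕ → ℤ[X], IsOddFaulhaberFamily P) ∧
    (∃ Q : ℕ → ℕ → ℤ[X], IsEvenFaulhaberFamily Q) ∧
    (∀ P : ℕ → ℕ → ℤ[X], IsOddFaulhaberFamily P → ∀ m k : ℕ, k ≤ m →
      P m k = pathFamilySum weightP (startPoint k) (endPoint m k) ∧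
        ∀ d : ℕ, 0 ≤ (P m k).coeff d) ∧
    (∀ Q : ℕ → ℕ → ℤ[X], IsEvenFaulhaberFamily Q → ∀ m k : ℕ, 1 ≤ m → k ≤ m →
      Q m k = pathFamilySum (weightQ (startPoint k)) (startPoint k) (endPoint m k) ∧
        ∀ d : ℕ, 0 ≤ (Q m k).coeff d) := by
  refine ⟨⟨faulhaberDet X 0, (isOddFaulhaberFamily_iff _).2 fun _ _ _ => rfl⟩,
    ⟨faulhaberDet (X ^ 2) X, (isEvenFaulhaberFamily_iff _).2 fun _ _ _ _ => rfl⟩,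
    fun P hP m k hk => ?_, fun Q hQ m k hm hk => ?_⟩
  · rw [(isOddFaulhaberFamily_iff P).1 hP m k hk]
    refine ⟨?_, faulhaberDet_coeff_nonneg X_mem_rangeS (Subsemiring.zero_mem _) hk⟩
    rw [weightP_eq_stepWeight k, pathFamilySum_eq_faulhaberDet X 0 hk]
  · rw [(isEvenFaulhaberFamily_iff Q).1 hQ m k hm hk]
    refine ⟨?_, faulhaberDet_coeff_nonneg (Subsemiring.pow_mem _ X_mem_rangeS 2)
      X_mem_rangeS hk⟩
    rw [weightQ_eq_stepWeight, pathFamilySum_eq_faulhaberDet (X ^ 2) X hk]
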